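/- Let $p,q\in\mathbb C$ with $0<|p|,|q|<1$. Put $(z;q)_\infty=\prod_{j\ge0}(1-zq^j)$, $\theta(z;p)=(z;p)_\infty(p/z;p)_\infty$, $$\Gamma(z)=\prod_{i,j\ge 0}\frac{1-z^{-1}p^{i+1}q^{j+1}}{1-zp^iq^j},\qquad \theta(z)_n=\prod_{j=0}^{n-1}\theta(zq^j;p)\ (n\ge0),\qquad \theta(z)_n=\prod_{j=1}^{-n}\frac1{\theta(zq^{-j};p)}\ (n<0),$$ $\kappa=(p;p)_\infty(q;q)_\infty/(4\pi \mathrm i)$, and, with a product over all sign choices understood in $\pm$, $$K_{t}(x,z)=\frac{\Gamma(tx^{\pm1}z^{\pm1})}{\Gamma(t^2)\,\Gamma(z^{\pm2})},\qquad M_{nm}(a,k)=\frac{\theta(k)_{n+m}\,\theta(k/a)_{n-m}}{\theta(qa)_{n+m}\,\theta(q)_{n-m}}\;\frac{\theta(aq^{2m};p)}{\theta(a;p)}\,a^{n-m}.$$ Let $N\ge0$ be an integer, $a,k\in\mathbb C\setminus\{0\}$ with fixed square roots $a^{1/2},k^{1/2}$, and set $z_0=a^{1/2}$, $t=k^{1/2}/a^{1/2}$,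 $x_\epsilon=\epsilon^{-1}k^{1/2}q^N$. Assume $|z_0|<1$ and the genericity conditions, for all integers $i,j\ge0$: $$q^i\ne p^j\ (1\le i\le N),\quad \tfrac ka q^ip^j\ne1,\quad \tfrac ka\neq q^{i+1}p^{j+1},\quad kq^ip^j\ne1,\quad aq^{2N}\ne q^ip^j,\quad k^2q^{2N}q^ip^j\ne a .$$ Let $\alpha$ be holomorphic on $\mathbb C\setminus\{0\}$ except for at most simple poles at the points $z_0q^m$, $m=0,\dots,N$, and at their reciprocals, with $\alpha(1/z)=\alpha(z)$, and let $\tilde\alpha_m=\lim_{z\to z_0q^m}(1-z_0q^m/z)\,\alpha(z)$. The elliptic Fourier transform of $\alpha$ is $\beta(x)=M(t)_{xz}\alpha(z)=\kappa\int_C K_t(x,z)\,\alpha(z)\,\frac{dz}{z}$. Here $C$ is any contour (a finite sum of closed piecewise $C^1$ curves of finite length) that meets no pole and has winding number $1$ about $0$, about all $tx^{\pm1}q^ip^j$ ($i,j\ge0$) and about all $z_0q^m$ ($0\le m\le N$), and winding number $0$ about the reciprocals of the points $tx^{\pm1}q^ip^j$, $z_0q^m$; if $|tx|,|t/x|<1$,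 the unit circle is such a contour. Call $C'$ a deformed contour at $x$ if it satisfies the same conditions except that it has winding number $0$ about the points $z_0q^m$ and $1$ about their reciprocals, $0\le m\le N$. Then: 1. For all $\epsilon\ne1$ in a neighbourhood of $1$ in $\mathbb C$, $\beta(x_\epsilon)$ is well defined: such contours $C$ exist, and the integral does not depend on the choice. 2. Deformed contours at $x_1$ exist. If $C'$ is one of them, then for all $\epsilon\neq1$ close enough to $1$ it is a deformed contour at $x_\epsilon$ and $$\beta(x_\epsilon)=\kappa\int_{C'}K_t(x_\epsilon,z)\,\alpha(z)\,\frac{dz}{z}+4\pi \mathrm i\,\kappa\sum_{m=0}^N K_t(x_\epsilon,z_0q^m)\,\tilde\alpha_m ,$$ and $(1-\epsilon)\,\kappa\int_{C'}K_t(x_\epsilon,z)\,\alpha(z)\,\frac{dz}{z}\to0$ as $\epsilon\to1$. 3. The limit $\tilde\beta_N=\lim_{\epsilon\to1}(1-\epsilon)\,\beta(x_\epsilon)$ exists, and with $\beta_N=q^{-N(N+1)}\tilde\beta_N$ and $\alpha_m=q^{-m(m+1)}\frac{\Gamma(k)}{\Gamma(a)}\tilde\alpha_m$ one has $$\beta_N=\sum_{m=0}^N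 M_{Nm}(a,k)\,\alpha_m .$$ 4. The matrix $M(a,k)$ is triangular: $M_{nm}(a,k)=0$ for $m>n$ (owing to the factor $1/\theta(q)_{n-m}$, read as $\prod_{j=1}^{m-n}\theta(q^{1-j};p)=0$). -/

import Mathlib

open Filter Topology

noncomputable section

namespace EllipticBailey

/-- The infinite `q`-Pochhammer symbol `(z; q)_∞ = ∏_{j ≥ 0} (1 - z q^j)`. -/
def qPochInf (z q : ℂ) : ℂ := ∏' j : ℕ, (1 - z * q ^ j)

/-- The short Jacobi theta function `θ(z; p) = (z; p)_∞ (p / z; p)_∞`. -/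
def theta (z p : ℂ) : ℂ := qPochInf z p * qPochInf (p * z⁻¹) p

/-- The elliptic gamma function
`Γ(z; p, q) = ∏_{j, k ≥ 0} (1 - z⁻¹ p^(j+1) q^(k+1)) / (1 - z p^j q^k)`. -/
def ellGamma (p q z : ℂ) : ℂ :=
  (∏' jk : ℕ × ℕ, (1 - z⁻¹ * p ^ (jk.1 + 1) * q ^ (jk.2 + 1))) /
    ∏' jk : ℕ × ℕ, (1 - z * p ^ jk.1 * q ^ jk.2)

/-- The elliptic Pochhammer symbol `θ(z; p)_n` (with base `q`), for an integer `n`: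
`∏_{j=0}^{n-1} θ(z q^j; p)` if `n ≥ 0`, and `∏_{j=1}^{-n} 1 / θ(z q^{-j}; p)` if `n < 0`. -/
def ellPoch (p q z : ℂ) : ℤ → ℂ
  | Int.ofNat n => ∏ j ∈ Finset.range n, theta (z * q ^ j) p
  | Int.negSucc n => ∏ j ∈ Finset.Icc 1 (n + 1), (theta (z * (q ^ j)⁻¹) p)⁻¹

/-- The elliptic Bressoud-type matrix `M_{Nm}(a, k)`. -/
def baileyMatrix (p q a k : ℂ) (N m : ℕ) : ℂ :=
  (ellPoch p q k ((N : ℤ) + m) * ellPoch p q (k / a) ((N : ℤ) - m)) /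
      (ellPoch p q (q * a) ((N : ℤ) + m) * ellPoch p q q ((N : ℤ) - m)) *
    (theta (a * q ^ (2 * m)) p / theta a p) * a ^ ((N : ℤ) - m)

/-- A closed, piecewise continuously differentiable curve of finite length in the complex plane,
parametrized by `[0, 1]`. -/
structure ClosedCurve where
  toFun : ℝ → ℂ
  continuousOn : ContinuousOn toFun (Set.Icc 0 1)
  closed : toFun 0 = toFun 1
  breaks : Finset ℝ
  differentiableAt : ∀ s ∈ Set.Ioo (0 : ℝ) 1 \ (breaks : Set ℝ), DifferentiableAt ℝ toFun s
  continuousOn_deriv : ContinuousOn (deriv toFun) (Set.Ioo (0 : ℝ) 1 \ (breaks : Set ℝ))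
  integrable_deriv : IntervalIntegrable (deriv toFun) MeasureTheory.volume 0 1

/-- An integration contour: a finite sum of closed curves (a cycle). -/
abbrev Contour := List ClosedCurve

/-- The set of points of the contour. -/
def Contour.support (C : Contour) : Set ℂ := {z | ∃ γ ∈ C, ∃ s ∈ Set.Icc (0 : ℝ) 1, γ.toFun s = z}

/-- The contour integral `∫_C f(z) dz`. -/
def Contour.integral (C : Contour) (f : ℂ → ℂ) : ℂ :=
  (C.map fun γ => ∫ s in (0 : ℝ)..1, f (γ.toFun s) * deriv γ.toFun s).sum

/-- The winding number of the contour about `w` (meaningful for `w` off the contour). -/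
def Contour.winding (C : Contour) (w : ℂ) : ℂ :=
  (2 * Real.pi * Complex.I)⁻¹ * C.integral fun z => (z - w)⁻¹

/-- The contour separates `I` (encircled once, counterclockwise) from `O` (not encircled),
and it passes through no point of either set. -/
def Contour.Separates (C : Contour) (I O : Set ℂ) : Prop :=
  (∀ w ∈ I, w ∉ C.support ∧ C.winding w = 1) ∧ (∀ w ∈ O, w ∉ C.support ∧ C.winding w = 0)

/-- The kernel `Γ(t x^{±1} z^{±1}; p, q) / Γ(t^2, z^{±2}; p, q)` of the elliptic Fourier
transform. -/
def kernel (p q t x z : ℂ) : ℂ :=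
  (ellGamma p q (t * x * z) * ellGamma p q (t * x * z⁻¹) *
      ellGamma p q (t * x⁻¹ * z) * ellGamma p q (t * x⁻¹ * z⁻¹)) /
    (ellGamma p q (t ^ 2) * (ellGamma p q (z ^ 2) * ellGamma p q (z⁻¹ ^ 2)))

/-- The poles `t x^{±1} q^i p^j` of the kernel, which accumulate at the origin. The other poles
of the kernel are their reciprocals. -/
def kernelPoles (p q t x : ℂ) : Set ℂ :=
  {w | ∃ i j : ℕ, w = t * x * q ^ i * p ^ j ∨ w = t * x⁻¹ * q ^ i * p ^ j}

/-- The points `z₀ q^m`, `m = 0, …, N`. -/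
def seqPoles (q z₀ : ℂ) (N : ℕ) : Set ℂ := {w | ∃ m : ℕ, m ≤ N ∧ w = z₀ * q ^ m}

/-- `κ = (p; p)_∞ (q; q)_∞ / (4 π i)`. -/
def kappa (p q : ℂ) : ℂ := qPochInf p p * qPochInf q q / (4 * Real.pi * Complex.I)

/-- `κ ∫_C Γ(t x^{±1} z^{±1}) / Γ(t^2, z^{±2}) α(z) dz / z`. -/
def eftIntegral (p q t x : ℂ) (α : ℂ → ℂ) (C : Contour) : ℂ :=
  kappa p q * C.integral fun z => kernel p q t x z * α z / z

/-- The contours that define the elliptic Fourier transform at `(t, x)` of a function whose poles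
in the punctured plane are at `A` (inside) and at the reciprocals of `A` (outside): the origin, the
kernel poles converging to it, and `A` are encircled; all the reciprocal poles are not. The unit
circle is of this kind if `|t x|, |t / x| < 1` and `A` lies in the open unit disc. -/
def IsDefiningContour (p q t x : ℂ) (A : Set ℂ) (C : Contour) : Prop :=
  C.Separates ({0} ∪ kernelPoles p q t x ∪ A) {w | w⁻¹ ∈ kernelPoles p q t x ∪ A}

/-- The contours obtained from the defining ones by crossing the poles at `A` and at the
reciprocals of `A`, but no pole of the kernel: now the reciprocals of `A` are encircled and `A` is
not. -/
def IsDeformedContour (p q t x : ℂ) (A : Set ℂ) (C : Contour) : Prop :=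
  C.Separates ({0} ∪ kernelPoles p q t x ∪ {w | w⁻¹ ∈ A}) ({w | w⁻¹ ∈ kernelPoles p q t x} ∪ A)

/-- `b` is the value at `x` of the (analytically continued) elliptic Fourier transform
`M(t)_{xz} α(z)`, where `A` is the set of the poles of `α` that count as inner ones. -/
def IsEFT (p q t x : ℂ) (A : Set ℂ) (α : ℂ → ℂ) (b : ℂ) : Prop :=
  ∃ C : Contour, IsDefiningContour p q t x A C ∧ b = eftIntegral p q t x α C

end EllipticBailey

end

/-!
The kernel `K_t(x, z)` is holomorphic in `z` off a set that is discrete in `ℂ \ {0}`, so the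
homology form of Cauchy's theorem (proved by Dixon's argument) shows that `β(x)` depends only on the
winding numbers of the contour. Replacing `C` by a deformed contour `C'` crosses the points
`z₀ q ^ m` and their reciprocals; by the symmetry `z ↦ 1 / z` of the integrand each pair contributes
the same residue twice. As `ε → 1` no pole of the kernel meets `C'`, so that the integral over `C'`
stays bounded and is killed by the factor `1 - ε`. The residues survive: `Γ(t x⁻¹ z)` has a simple
pole at `ε = 1` for each `z = z₀ q ^ m`, and the functional equation `Γ(q z) = θ(z; p) Γ(z)` turns
the limits into the entries `M_{Nm}(a, k)`.
-/

namespace EllipticBailey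

open Metric MeasureTheory Set Function

section GeneralAnalysis

theorem aestronglyMeasurable_of_hasDerivAt {𝕜 E Ω : Type*} [NontriviallyNormedField 𝕜]
    [NormedAddCommGroup E] [NormedSpace 𝕜 E] [MeasurableSpace Ω] {μ : Measure Ω}
    {F : 𝕜 → Ω → E} {F' : Ω → E} {x : 𝕜}
    (hF : ∀ᶠ y in 𝓝 x, AEStronglyMeasurable (F y) μ)
    (hF' : ∀ᵐ s ∂μ, HasDerivAt (fun y => F y s) (F' s) x) : AEStronglyMeasurable F' μ := by
  have hF_punctured : ∀ᶠ y in 𝓝[≠] x, AEStronglyMeasurable (F y) μ :=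
    hF.filter_mono nhdsWithin_le_nhds
  obtain ⟨u, hu, hmeas⟩ := exists_seq_forall_of_frequently hF_punctured.frequently
  refine aestronglyMeasurable_of_tendsto_ae atTop
    (fun n => ((hmeas n).sub hF.self_of_nhds).const_smul (u n - x)⁻¹) ?_
  filter_upwards [hF'] with s hs using hs.tendsto_slope.comp hu

theorem dslope_comm (f : ℂ → ℂ) (z w : ℂ) : dslope f z w = dslope f w z := by
  rcases eq_or_ne z w with rfl | h
  · rfl
  · rw [dslope_of_ne _ h, dslope_of_ne _ h.symm, slope_comm]

/-- At a diagonal point the continuity of `dslope` is strict differentiability of `f`. -/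
theorem continuousAt_uncurry_dslope_self {f : ℂ → ℂ} {z : ℂ} (hf : AnalyticAt ℂ f z) :
    ContinuousAt (uncurry (dslope f)) (z, z) := by
  rw [ContinuousAt, uncurry_apply_pair, dslope_same, Metric.tendsto_nhds]
  intro δ hδ
  filter_upwards [hf.hasStrictDerivAt.isLittleO.def (half_pos hδ),
    continuousAt_fst.eventually (hf.deriv.continuousAt.eventually (ball_mem_nhds _ hδ))]
    with ⟨u, v⟩ huv hu
  rcases eq_or_ne v u with rfl | hvu
  · simpa using hu
  · have hne : u - v ≠ 0 := sub_ne_zero.2 hvu.symm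
    have heq : slope f u v - deriv f z = (f u - f v - deriv f z * (u - v)) / (u - v) := by
      rw [slope_comm, slope_def_field]
      field_simp
    rw [uncurry_apply_pair, dslope_of_ne _ hvu, dist_eq_norm, heq, norm_div]
    refine lt_of_le_of_lt ?_ (half_lt_self hδ)
    rw [div_le_iff₀ (norm_pos_iff.2 hne)]
    simpa [mul_comm] using huv

theorem continuousOn_uncurry_dslope {f : ℂ → ℂ} {U : Set ℂ} (hU : IsOpen U)
    (hf : DifferentiableOn ℂ f U) : ContinuousOn (uncurry (dslope f)) (U ×ˢ U) := by
  rintro ⟨z, w⟩ ⟨hz, hw⟩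
  refine ContinuousAt.continuousWithinAt ?_
  rcases eq_or_ne w z with rfl | hwz
  · exact continuousAt_uncurry_dslope_self (hf.analyticAt (hU.mem_nhds hw))
  · have hfz : ContinuousAt (fun y : ℂ × ℂ => f y.1) (z, w) :=
      (hf.continuousOn.continuousAt (hU.mem_nhds hz)).comp continuousAt_fst
    have hfw : ContinuousAt (fun y : ℂ × ℂ => f y.2) (z, w) :=
      ContinuousAt.comp (hf.continuousOn.continuousAt (hU.mem_nhds hw)) continuousAt_snd
    have hslope : ContinuousAt (fun y : ℂ × ℂ => (f y.2 - f y.1) / (y.2 - y.1)) (z, w) :=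
      (hfw.sub hfz).div (by fun_prop) (sub_ne_zero.2 hwz)
    refine hslope.congr ?_
    filter_upwards [(isOpen_ne_fun continuous_snd continuous_fst).mem_nhds hwz] with ⟨u, v⟩ huv
    rw [uncurry_apply_pair, dslope_of_ne _ huv, slope_def_field]

end GeneralAnalysis

namespace ClosedCurve

variable (γ : ClosedCurve)

/-- The trace `γ([0, 1])` of a closed curve. -/
def image : Set ℂ := γ.toFun '' Icc 0 1

/-- The integral `∫_γ f(z) dz` along one closed curve; `Contour.integral` is the sum of these. -/
noncomputable def integral (f : ℂ → ℂ) : ℂ := ∫ s in (0 : ℝ)..1, f (γ.toFun s) * deriv γ.toFun s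

theorem isCompact_image : IsCompact γ.image :=
  isCompact_Icc.image_of_continuousOn γ.continuousOn

theorem mem_image_of_mem_uIoc {s : ℝ} (hs : s ∈ uIoc (0 : ℝ) 1) : γ.toFun s ∈ γ.image := by
  rw [uIoc_of_le zero_le_one] at hs
  exact mem_image_of_mem _ (Ioc_subset_Icc_self hs)

theorem intervalIntegrable_mul_deriv {f : ℂ → ℂ} (hf : ContinuousOn f γ.image) :
    IntervalIntegrable (fun s => f (γ.toFun s) * deriv γ.toFun s) volume 0 1 := by
  have hcomp : ContinuousOn (fun s => f (γ.toFun s)) (uIcc 0 1) := by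
    rw [uIcc_of_le zero_le_one]
    exact hf.comp γ.continuousOn (mapsTo_image _ _)
  exact γ.integrable_deriv.continuousOn_mul hcomp

theorem integral_eq_zero_of_hasDerivAt {F F' : ℂ → ℂ}
    (hF : ∀ z ∈ γ.image, HasDerivAt F (F' z) z) (hF' : ContinuousOn F' γ.image) :
    γ.integral F' = 0 := by
  rw [integral, integral_eq_of_hasDerivAt_off_countable_of_le (fun s => F (γ.toFun s)) _
    zero_le_one γ.breaks.countable_toSet _ _ (γ.intervalIntegrable_mul_deriv hF')]
  · rw [γ.closed, sub_self]
  · exact ContinuousOn.comp (fun z hz => (hF z hz).continuousAt.continuousWithinAt)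
      γ.continuousOn (mapsTo_image _ _)
  · intro s hs
    exact (hF _ (mem_image_of_mem _ (Ioo_subset_Icc_self hs.1))).comp s
      (γ.differentiableAt s hs).hasDerivAt

theorem hasDerivAt_integral {F : ℂ → ℂ → ℂ} {U : Set ℂ} {z₀ : ℂ} (hU : U ∈ 𝓝 z₀)
    (hcont : ContinuousOn (uncurry F) (U ×ˢ γ.image))
    (hdiff : ∀ w ∈ γ.image, DifferentiableOn ℂ (fun z => F z w) U) :
    HasDerivAt (fun z => γ.integral (F z)) (γ.integral fun w => deriv (fun z => F z w) z₀) z₀ := by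
  obtain ⟨r, hr, hrU⟩ := nhds_basis_closedBall.mem_iff.1 hU
  obtain ⟨M, hM⟩ := ((isCompact_closedBall z₀ r).prod γ.isCompact_image)
    |>.exists_bound_of_continuousOn (hcont.mono (prod_mono_left hrU))
  have hintegrable : ∀ z ∈ closedBall z₀ r,
      IntervalIntegrable (fun s => F z (γ.toFun s) * deriv γ.toFun s) volume 0 1 := fun z hz =>
    γ.intervalIntegrable_mul_deriv (hcont.uncurry_left z (hrU hz))
  have hderiv : ∀ s ∈ uIoc (0 : ℝ) 1, ∀ z ∈ ball z₀ (r / 2),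
      HasDerivAt (fun z => F z (γ.toFun s) * deriv γ.toFun s)
        (deriv (fun z => F z (γ.toFun s)) z * deriv γ.toFun s) z := fun s hs z hz =>
    ((hdiff _ (γ.mem_image_of_mem_uIoc hs)).differentiableAt (mem_of_superset
      (isOpen_ball.mem_nhds (ball_subset_ball (half_le_self hr.le) hz))
      (ball_subset_closedBall.trans hrU))).hasDerivAt.mul_const _
  have hmeas : ∀ᶠ z in 𝓝 z₀, AEStronglyMeasurable
      (fun s => F z (γ.toFun s) * deriv γ.toFun s) (volume.restrict (uIoc 0 1)) := by
    filter_upwards [closedBall_mem_nhds z₀ hr] with z hz using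
      (hintegrable z hz).def'.aestronglyMeasurable
  refine (intervalIntegral.hasDerivAt_integral_of_dominated_loc_of_deriv_le
    (F' := fun z s => deriv (fun z => F z (γ.toFun s)) z * deriv γ.toFun s)
    (bound := fun s => M / (r / 2) * ‖deriv γ.toFun s‖)
    (ball_mem_nhds z₀ (half_pos hr)) hmeas (hintegrable z₀ (mem_closedBall_self hr.le)) ?_ ?_
    (γ.integrable_deriv.norm.const_mul _) (Eventually.of_forall hderiv)).2
  · refine aestronglyMeasurable_of_hasDerivAt hmeas ?_
    exact (ae_restrict_iff' measurableSet_uIoc).2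
      (Eventually.of_forall fun s hs => hderiv s hs z₀ (mem_ball_self (half_pos hr)))
  · refine Eventually.of_forall fun s hs z hz => ?_
    have hγ := γ.mem_image_of_mem_uIoc hs
    have hsub : closedBall z (r / 2) ⊆ closedBall z₀ r :=
      closedBall_subset_closedBall' (by linarith [mem_ball.1 hz])
    rw [norm_mul]
    gcongr
    exact Complex.norm_deriv_le_of_forall_mem_sphere_norm_le (half_pos hr)
      ((hdiff _ hγ).mono (closure_ball_subset_closedBall.trans (hsub.trans hrU))).diffContOnCl
      fun u hu => hM (u, γ.toFun s) ⟨hsub (sphere_subset_closedBall hu), hγ⟩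

/-- For each `w ∈ D` the parameters with `γ s = w` and `γ' s ≠ 0` are isolated, hence countable. -/
theorem integral_congr_of_countable {f g : ℂ → ℂ} {D : Set ℂ} (hD : D.Countable)
    (h : ∀ z ∈ γ.image, z ∉ D → f z = g z) : γ.integral f = γ.integral g := by
  have hcount : (⋃ w ∈ D, {s | γ.toFun s = w ∧ deriv γ.toFun s ≠ 0}).Countable := by
    refine hD.biUnion fun w _ => Countable.mono (fun s hs => ?_)
      (countable_setOfPred_isolated_right_within
        (s := {s | γ.toFun s = w ∧ deriv γ.toFun s ≠ 0}))
    have hne := (differentiableAt_of_deriv_ne_zero hs.2).hasDerivAt.eventually_ne (c := w) hs.2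
    refine ⟨hs, eventually_false_iff_eq_bot.1 ?_⟩
    filter_upwards [hne.filter_mono (nhdsWithin_mono _ fun u hu => ne_of_gt hu.2),
      self_mem_nhdsWithin] with u hu hu'
    exact hu hu'.1.1
  refine intervalIntegral.integral_congr_ae ?_
  filter_upwards [hcount.ae_notMem volume] with s hs hs'
  by_cases hsD : γ.toFun s ∈ D
  · have hzero : deriv γ.toFun s = 0 := by
      by_contra hne
      exact hs (mem_biUnion hsD ⟨rfl, hne⟩)
    simp only [hzero, mul_zero]
  · rw [h _ (γ.mem_image_of_mem_uIoc hs') hsD]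

theorem one_sub_mem_Ioo_diff {B : Finset ℝ} {s : ℝ}
    (hs : s ∈ Ioo (0 : ℝ) 1 \ (B.image (1 - ·) : Finset ℝ)) :
    1 - s ∈ Ioo (0 : ℝ) 1 \ (B : Set ℝ) :=
  ⟨⟨by linarith [hs.1.2], by linarith [hs.1.1]⟩, fun h =>
    hs.2 (Finset.mem_coe.2 (Finset.mem_image.2 ⟨1 - s, h, sub_sub_cancel 1 s⟩))⟩

theorem deriv_comp_one_sub : deriv (fun s => γ.toFun (1 - s)) = fun s => -deriv γ.toFun (1 - s) :=
  funext fun s => deriv_comp_const_sub γ.toFun 1 s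

/-- The curve run backwards, used to form differences of contours. -/
noncomputable def reverse : ClosedCurve where
  toFun s := γ.toFun (1 - s)
  continuousOn := γ.continuousOn.comp (by fun_prop) fun s hs =>
    ⟨by linarith [hs.2], by linarith [hs.1]⟩
  closed := by simpa using γ.closed.symm
  breaks := γ.breaks.image (1 - ·)
  differentiableAt s hs :=
    (γ.differentiableAt (1 - s) (one_sub_mem_Ioo_diff hs)).comp s (by fun_prop)
  continuousOn_deriv := by
    rw [γ.deriv_comp_one_sub]
    exact (γ.continuousOn_deriv.comp (by fun_prop) fun s hs => one_sub_mem_Ioo_diff hs).neg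
  integrable_deriv := by
    rw [γ.deriv_comp_one_sub]
    have h := γ.integrable_deriv.comp_sub_left 1
    rw [sub_zero, sub_self] at h
    exact h.symm.neg

theorem image_reverse : γ.reverse.image = γ.image := by
  have h : (fun s : ℝ => 1 - s) '' Icc 0 1 = Icc 0 1 := by simp
  conv_rhs => rw [image, ← h, ← image_comp]
  rfl

theorem integral_reverse (f : ℂ → ℂ) : γ.reverse.integral f = -γ.integral f := by
  have h := intervalIntegral.integral_comp_sub_left (a := 0) (b := 1)
    (fun s => f (γ.toFun s) * deriv γ.toFun s) 1
  rw [sub_self, sub_zero] at h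
  rw [integral, integral, ← h, ← intervalIntegral.integral_neg]
  simp only [reverse, deriv_comp_const_sub, mul_neg]

end ClosedCurve

namespace Contour

@[simp] theorem integral_nil (f : ℂ → ℂ) : Contour.integral [] f = 0 := rfl

theorem integral_cons (γ : ClosedCurve) (C : Contour) (f : ℂ → ℂ) :
    Contour.integral (γ :: C) f = γ.integral f + C.integral f := by
  simp [Contour.integral, ClosedCurve.integral]

theorem integral_append (C C' : Contour) (f : ℂ → ℂ) :
    Contour.integral (C ++ C') f = C.integral f + C'.integral f := by
  simp [Contour.integral]

theorem winding_append (C C' : Contour) (w : ℂ) :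
    Contour.winding (C ++ C') w = C.winding w + C'.winding w := by
  simp [Contour.winding, integral_append, mul_add]

@[simp] theorem support_nil : Contour.support [] = ∅ := by simp [Contour.support]

theorem support_cons (γ : ClosedCurve) (C : Contour) :
    Contour.support (γ :: C) = γ.image ∪ C.support := by
  ext z
  simp [Contour.support, ClosedCurve.image]

theorem support_append (C C' : Contour) :
    Contour.support (C ++ C') = C.support ∪ C'.support := by
  induction C with
  | nil => simp
  | cons γ C ih => rw [List.cons_append, support_cons, support_cons, ih, union_assoc]

theorem isCompact_support (C : Contour) : IsCompact C.support := by
  induction C with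
  | nil => simp
  | cons γ C ih => rw [support_cons]; exact γ.isCompact_image.union ih

theorem isOpen_compl_support (C : Contour) : IsOpen C.supportᶜ :=
  C.isCompact_support.isClosed.isOpen_compl

theorem integral_sub (C : Contour) {f g : ℂ → ℂ} (hf : ContinuousOn f C.support)
    (hg : ContinuousOn g C.support) :
    C.integral (fun z => f z - g z) = C.integral f - C.integral g := by
  induction C with
  | nil => simp
  | cons γ C ih =>
    rw [support_cons] at hf hg
    simp only [integral_cons, ClosedCurve.integral, sub_mul]
    rw [intervalIntegral.integral_sub
        (γ.intervalIntegrable_mul_deriv (hf.mono subset_union_left))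
        (γ.intervalIntegrable_mul_deriv (hg.mono subset_union_left)),
      ih (hf.mono subset_union_right) (hg.mono subset_union_right)]
    ring

theorem integral_finset_sum {ι : Type*} (C : Contour) (F : Finset ι) {f : ι → ℂ → ℂ}
    (hf : ∀ i ∈ F, ContinuousOn (f i) C.support) :
    C.integral (fun z => ∑ i ∈ F, f i z) = ∑ i ∈ F, C.integral (f i) := by
  induction C with
  | nil => simp
  | cons γ C ih =>
    rw [support_cons] at hf
    simp only [integral_cons, ClosedCurve.integral, Finset.sum_mul, Finset.sum_add_distrib]
    rw [intervalIntegral.integral_finsetSum fun i hi =>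
        γ.intervalIntegrable_mul_deriv ((hf i hi).mono subset_union_left),
      ih fun i hi => (hf i hi).mono subset_union_right]

theorem integral_const_mul (C : Contour) (c : ℂ) (f : ℂ → ℂ) :
    C.integral (fun z => c * f z) = c * C.integral f := by
  induction C with
  | nil => simp
  | cons γ C ih =>
    simp only [integral_cons, ClosedCurve.integral, mul_assoc, intervalIntegral.integral_const_mul,
      ih, mul_add]

theorem integral_congr_of_countable (C : Contour) {f g : ℂ → ℂ} {D : Set ℂ} (hD : D.Countable)
    (h : ∀ z ∈ C.support, z ∉ D → f z = g z) : C.integral f = C.integral g := by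
  induction C with
  | nil => simp
  | cons γ C ih =>
    rw [support_cons] at h
    rw [integral_cons, integral_cons, ih fun z hz => h z (Or.inr hz),
      γ.integral_congr_of_countable hD fun z hz => h z (Or.inl hz)]

theorem integral_congr (C : Contour) {f g : ℂ → ℂ} (h : ∀ z ∈ C.support, f z = g z) :
    C.integral f = C.integral g :=
  C.integral_congr_of_countable countable_empty fun z hz _ => h z hz

theorem integral_eq_zero_of_hasDerivAt (C : Contour) {F F' : ℂ → ℂ}
    (hF : ∀ z ∈ C.support, HasDerivAt F (F' z) z) (hF' : ContinuousOn F' C.support) :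
    C.integral F' = 0 := by
  induction C with
  | nil => simp
  | cons γ C ih =>
    rw [support_cons] at hF hF'
    rw [integral_cons, ih (fun z hz => hF z (Or.inr hz)) (hF'.mono subset_union_right),
      γ.integral_eq_zero_of_hasDerivAt (fun z hz => hF z (Or.inl hz))
        (hF'.mono subset_union_left), add_zero]

theorem hasDerivAt_integral (C : Contour) {F : ℂ → ℂ → ℂ} {U : Set ℂ} {z₀ : ℂ} (hU : U ∈ 𝓝 z₀)
    (hcont : ContinuousOn (uncurry F) (U ×ˢ C.support))
    (hdiff : ∀ w ∈ C.support, DifferentiableOn ℂ (fun z => F z w) U) :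
    HasDerivAt (fun z => C.integral (F z))
      (C.integral fun w => deriv (fun z => F z w) z₀) z₀ := by
  induction C with
  | nil => simpa using hasDerivAt_const z₀ (0 : ℂ)
  | cons γ C ih =>
    rw [support_cons] at hcont hdiff
    simp only [integral_cons]
    exact (γ.hasDerivAt_integral hU (hcont.mono (prod_mono_right subset_union_left))
      fun w hw => hdiff w (Or.inl hw)).add
      (ih (hcont.mono (prod_mono_right subset_union_right)) fun w hw => hdiff w (Or.inr hw))

/-- The contour run backwards: as a cycle this is `-C`. -/
noncomputable def reverse (C : Contour) : Contour := C.map ClosedCurve.reverse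

theorem integral_reverse (C : Contour) (f : ℂ → ℂ) : C.reverse.integral f = -C.integral f := by
  induction C with
  | nil => simp [reverse]
  | cons γ C ih =>
    rw [reverse] at ih ⊢
    rw [List.map_cons, integral_cons, integral_cons, ih, γ.integral_reverse, neg_add]

theorem winding_reverse (C : Contour) (w : ℂ) : C.reverse.winding w = -C.winding w := by
  rw [Contour.winding, integral_reverse, mul_neg, Contour.winding]

theorem support_reverse (C : Contour) : C.reverse.support = C.support := by
  induction C with
  | nil => rfl
  | cons γ C ih =>
    rw [reverse] at ih ⊢
    rw [List.map_cons, support_cons, support_cons, ih, γ.image_reverse]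

theorem integral_inv_sub (C : Contour) (w : ℂ) :
    C.integral (fun z => (z - w)⁻¹) = 2 * Real.pi * Complex.I * C.winding w := by
  rw [Contour.winding, mul_inv_cancel_left₀ Complex.two_pi_I_ne_zero]

theorem continuousOn_inv_sub {K : Set ℂ} {w : ℂ} (hw : w ∉ K) :
    ContinuousOn (fun z => (z - w)⁻¹) K :=
  ContinuousOn.inv₀ (by fun_prop) fun _ hz h => hw (sub_eq_zero.1 h ▸ hz)

theorem hasDerivAt_integral_mul_inv_sub (C : Contour) {f : ℂ → ℂ}
    (hf : ContinuousOn f C.support) {z₀ : ℂ} (hz₀ : z₀ ∉ C.support) :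
    HasDerivAt (fun z => C.integral fun w => f w * (w - z)⁻¹)
      (C.integral fun w => f w * ((w - z₀) ^ 2)⁻¹) z₀ := by
  have hne : ∀ z ∈ C.supportᶜ, ∀ w ∈ C.support, w - z ≠ 0 := fun z hz w hw h =>
    hz (sub_eq_zero.1 h ▸ hw)
  have hderiv : ∀ z ∈ C.supportᶜ, ∀ w ∈ C.support,
      HasDerivAt (fun z => f w * (w - z)⁻¹) (f w * ((w - z) ^ 2)⁻¹) z := fun z hz w hw => by
    simpa [div_eq_mul_inv] using
      (((hasDerivAt_id z).const_sub w).inv (hne z hz w hw)).const_mul (f w)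
  have hcont : ContinuousOn (uncurry fun z w => f w * (w - z)⁻¹) (C.supportᶜ ×ˢ C.support) :=
    (hf.comp continuousOn_snd fun _ hy => hy.2).mul
      (ContinuousOn.inv₀ (by fun_prop) fun y hy => hne y.1 hy.1 y.2 hy.2)
  refine (C.hasDerivAt_integral (C.isOpen_compl_support.mem_nhds hz₀) hcont fun w hw z hz =>
    (hderiv z hz w hw).differentiableAt.differentiableWithinAt).congr_deriv ?_
  exact C.integral_congr fun w hw => (hderiv z₀ hz₀ w hw).deriv

theorem hasDerivAt_winding (C : Contour) {z₀ : ℂ} (hz₀ : z₀ ∉ C.support) :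
    HasDerivAt C.winding 0 z₀ := by
  have hne : ∀ z ∈ C.support, z - z₀ ≠ 0 := fun z hz h => hz₀ (sub_eq_zero.1 h ▸ hz)
  have hprimitive : C.integral (fun w => 1 * ((w - z₀) ^ 2)⁻¹) = 0 := by
    refine C.integral_eq_zero_of_hasDerivAt (F := fun w => -(w - z₀)⁻¹) (fun z hz => ?_) ?_
    · have hinv : HasDerivAt (fun w => -(w - z₀)⁻¹) _ z :=
        (((hasDerivAt_id z).sub_const z₀).inv (hne z hz)).neg
      simpa [div_eq_mul_inv] using hinv
    · exact continuousOn_const.mul (ContinuousOn.inv₀ (by fun_prop) fun z hz =>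
        pow_ne_zero 2 (hne z hz))
  have h := (C.hasDerivAt_integral_mul_inv_sub (f := fun _ => 1) continuousOn_const hz₀).const_mul
    (2 * Real.pi * Complex.I : ℂ)⁻¹
  rw [hprimitive, mul_zero] at h
  have heq : C.winding = fun z =>
      (2 * Real.pi * Complex.I)⁻¹ * C.integral fun w => 1 * (w - z)⁻¹ :=
    funext fun z => by simp only [one_mul, Contour.winding]
  rwa [heq]

theorem eventually_winding_eq (C : Contour) {z₀ : ℂ} (hz₀ : z₀ ∉ C.support) :
    ∀ᶠ z in 𝓝 z₀, z ∉ C.support ∧ C.winding z = C.winding z₀ := by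
  obtain ⟨r, hr, hsub⟩ := Metric.isOpen_iff.1 C.isOpen_compl_support z₀ hz₀
  filter_upwards [ball_mem_nhds z₀ hr] with z hz
  refine ⟨hsub hz, ?_⟩
  exact isOpen_ball.is_const_of_deriv_eq_zero (convex_ball z₀ r).isPreconnected
    (fun w hw => (C.hasDerivAt_winding (hsub hw)).differentiableAt.differentiableWithinAt)
    (fun w hw => (C.hasDerivAt_winding (hsub hw)).deriv) hz (mem_ball_self hr)

theorem isOpen_setOf_winding_eq (C : Contour) (c : ℂ) :
    IsOpen {z | z ∉ C.support ∧ C.winding z = c} :=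
  isOpen_iff_mem_nhds.2 fun _ hz =>
    (C.eventually_winding_eq hz.1).mono fun _ hw => ⟨hw.1, hw.2.trans hz.2⟩

theorem integral_eq_zero_of_differentiableOn_ball (C : Contour) {f : ℂ → ℂ} {c : ℂ} {r : ℝ}
    (hf : DifferentiableOn ℂ f (ball c r)) (hC : C.support ⊆ ball c r) : C.integral f = 0 := by
  obtain ⟨F, hF⟩ := hf.isExactOn_ball
  exact C.integral_eq_zero_of_hasDerivAt (fun z hz => hF z (hC hz)) (hf.continuousOn.mono hC)

theorem winding_eq_zero_of_notMem_ball (C : Contour) {c z : ℂ} {r : ℝ}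
    (hC : C.support ⊆ ball c r) (hz : z ∉ ball c r) : C.winding z = 0 := by
  rw [Contour.winding, C.integral_eq_zero_of_differentiableOn_ball _ hC, mul_zero]
  exact DifferentiableOn.inv (by fun_prop) fun w hw h => hz (sub_eq_zero.1 h ▸ hw)

/-- In the coordinate `u = 1 / z` at infinity the integral is `u` times a function that is
holomorphic at `u = 0`. -/
theorem tendsto_integral_mul_inv_sub_cobounded (C : Contour) {f : ℂ → ℂ}
    (hf : ContinuousOn f C.support) :
    Tendsto (fun z => C.integral fun w => f w * (w - z)⁻¹) (Bornology.cobounded ℂ) (𝓝 0) := by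
  obtain ⟨R, hR, hCR⟩ := C.isCompact_support.isBounded.subset_ball_lt 0 0
  have hne : ∀ u ∈ ball (0 : ℂ) R⁻¹, ∀ w ∈ C.support, u * w - 1 ≠ 0 := by
    intro u hu w hw h
    have h1 : ‖u * w‖ = 1 := by rw [sub_eq_zero.1 h, norm_one]
    have hwR : ‖w‖ < R := mem_ball_zero_iff.1 (hCR hw)
    have huR : ‖u‖ * R < 1 := by
      rw [← lt_div_iff₀ hR, one_div]; exact mem_ball_zero_iff.1 hu
    rw [norm_mul] at h1
    nlinarith [norm_nonneg u]
  have hcont : ContinuousOn (uncurry fun u w => f w * (u * w - 1)⁻¹)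
      (ball 0 R⁻¹ ×ˢ C.support) :=
    (hf.comp continuousOn_snd fun _ hy => hy.2).mul
      (ContinuousOn.inv₀ (by fun_prop) fun y hy => hne y.1 hy.1 y.2 hy.2)
  have hcontAt : ContinuousAt (fun u => C.integral fun w => f w * (u * w - 1)⁻¹) 0 :=
    (C.hasDerivAt_integral (ball_mem_nhds 0 (inv_pos.2 hR)) hcont fun w hw =>
      (DifferentiableOn.inv (by fun_prop) fun u hu => hne u hu w hw).const_mul _).continuousAt
  have hlim := (tendsto_id.mul hcontAt.tendsto).comp (tendsto_inv₀_cobounded (α := ℂ))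
  rw [zero_mul] at hlim
  refine hlim.congr' ?_
  filter_upwards [Bornology.eventually_ne_cobounded (0 : ℂ)] with z hz
  simp only [comp_apply, id_eq]
  rw [← integral_const_mul]
  refine C.integral_congr fun w _ => ?_
  have hrw : w - z = z * (z⁻¹ * w - 1) := by field_simp
  rw [hrw, mul_inv]
  ring

theorem differentiableAt_integral_dslope (C : Contour) {f : ℂ → ℂ} {U : Set ℂ} (hU : IsOpen U)
    (hf : DifferentiableOn ℂ f U) (hC : C.support ⊆ U) {z₀ : ℂ} (hz₀ : z₀ ∈ U) :
    DifferentiableAt ℂ (fun z => C.integral (dslope f z)) z₀ := by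
  refine (C.hasDerivAt_integral (hU.mem_nhds hz₀)
    ((continuousOn_uncurry_dslope hU hf).mono (prod_mono_right hC))
    fun w hw => ?_).differentiableAt
  simp_rw [fun z => dslope_comm f z w]
  exact (Complex.differentiableOn_dslope (hU.mem_nhds (hC hw))).2 hf

theorem integral_dslope_of_winding_eq_zero (C : Contour) {f : ℂ → ℂ}
    (hf : ContinuousOn f C.support) {z : ℂ} (hz : z ∉ C.support) (hwind : C.winding z = 0) :
    C.integral (dslope f z) = C.integral fun w => f w * (w - z)⁻¹ := by
  have hinv := continuousOn_inv_sub hz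
  calc C.integral (dslope f z)
      = C.integral (fun w => f w * (w - z)⁻¹ - f z * (w - z)⁻¹) := by
        refine C.integral_congr fun w hw => ?_
        have hwz : w ≠ z := fun h => hz (h ▸ hw)
        rw [dslope_of_ne _ hwz, slope_def_field, div_eq_mul_inv, sub_mul]
    _ = C.integral fun w => f w * (w - z)⁻¹ := by
        rw [C.integral_sub (f := fun w => f w * (w - z)⁻¹) (g := fun w => f z * (w - z)⁻¹)
            (hf.mul hinv) (continuousOn_const.mul hinv), integral_const_mul, integral_inv_sub,
          hwind, mul_zero, mul_zero, sub_zero]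

open Classical in
/-- Dixon's argument: the two formulas for this function agree where both make sense, so it is
entire, and it vanishes at infinity. -/
theorem integral_dslope_eq_zero (C : Contour) {f : ℂ → ℂ} {U : Set ℂ} (hU : IsOpen U)
    (hf : DifferentiableOn ℂ f U) (hC : C.support ⊆ U) (hwind : ∀ z ∉ U, C.winding z = 0)
    (z : ℂ) :
    (if z ∈ U then C.integral (dslope f z) else C.integral fun w => f w * (w - z)⁻¹) = 0 := by
  set h : ℂ → ℂ := fun z =>
    if z ∈ U then C.integral (dslope f z) else C.integral fun w => f w * (w - z)⁻¹
  have hfC := hf.continuousOn.mono hC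
  have h_eq : ∀ z, z ∉ C.support → C.winding z = 0 →
      h z = C.integral fun w => f w * (w - z)⁻¹ := fun z hz hz' => by
    simp only [h, C.integral_dslope_of_winding_eq_zero hfC hz hz', ite_self]
  have hdiff : Differentiable ℂ h := by
    intro z
    by_cases hzU : z ∈ U
    · refine (C.differentiableAt_integral_dslope hU hf hC hzU).congr_of_eventuallyEq ?_
      filter_upwards [hU.mem_nhds hzU] with w hw using if_pos hw
    · have hzC : z ∉ C.support := fun hz => hzU (hC hz)
      refine (C.hasDerivAt_integral_mul_inv_sub hfC hzC).differentiableAt.congr_of_eventuallyEq ?_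
      filter_upwards [(C.isOpen_setOf_winding_eq 0).mem_nhds ⟨hzC, hwind z hzU⟩] with w hw
      exact h_eq w hw.1 hw.2
  obtain ⟨R, hCR⟩ := C.isCompact_support.isBounded.subset_ball 0
  refine hdiff.apply_eq_of_tendsto_cocompact z ?_
  rw [← Metric.cobounded_eq_cocompact]
  refine (C.tendsto_integral_mul_inv_sub_cobounded hfC).congr' ?_
  filter_upwards [Bornology.isBounded_def.1 (isBounded_ball (x := (0 : ℂ)) (r := R))] with z hz
  exact (h_eq z (fun hzC => hz (hCR hzC)) (C.winding_eq_zero_of_notMem_ball hCR hz)).symm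

theorem integral_eq_zero_of_winding_eq_zero (C : Contour) {f : ℂ → ℂ} {U : Set ℂ} (hU : IsOpen U)
    (hf : DifferentiableOn ℂ f U) (hC : C.support ⊆ U) (hwind : ∀ z ∉ U, C.winding z = 0) :
    C.integral f = 0 := by
  classical
  obtain ⟨R, hCR⟩ := C.isCompact_support.isBounded.subset_ball 0
  obtain ⟨z, hz⟩ : ∃ z : ℂ, z ∉ ball 0 R :=
    (nonempty_compl.2 fun h => NormedSpace.unbounded_univ ℂ ℂ (h ▸ isBounded_ball))
  have hzC : z ∉ C.support := fun h => hz (hCR h)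
  have hg : DifferentiableOn ℂ (fun w => f w * (w - z)) U := hf.mul (by fun_prop)
  have h := C.integral_dslope_eq_zero hU hg hC hwind z
  rw [C.integral_dslope_of_winding_eq_zero (hg.continuousOn.mono hC) hzC
    (C.winding_eq_zero_of_notMem_ball hCR hz), ite_self] at h
  rw [← h]
  refine C.integral_congr fun w hw => ?_
  have hne : w - z ≠ 0 := fun h0 => hzC (sub_eq_zero.1 h0 ▸ hw)
  rw [mul_inv_cancel_right₀ hne]

theorem integral_eq_of_winding_eq (C C' : Contour) {f : ℂ → ℂ} {U : Set ℂ} (hU : IsOpen U)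
    (hf : DifferentiableOn ℂ f U) (hC : C.support ⊆ U) (hC' : C'.support ⊆ U)
    (hwind : ∀ z ∉ U, C.winding z = C'.winding z) : C.integral f = C'.integral f := by
  have h := integral_eq_zero_of_winding_eq_zero (C ++ C'.reverse) hU hf
    (by rw [support_append, support_reverse]; exact union_subset hC hC')
    fun z hz => by rw [winding_append, winding_reverse, hwind z hz, add_neg_cancel]
  rwa [integral_append, integral_reverse, ← sub_eq_add_neg, sub_eq_zero] at h

end Contour

section Residues

theorem exists_differentiableOn_sub_simple_pole {f : ℂ → ℂ} {U : Set ℂ} {s r : ℂ}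
    (hU : U ∈ 𝓝 s) (hf : DifferentiableOn ℂ f (U \ {s}))
    (hlim : Tendsto (fun z => (z - s) * f z) (𝓝[≠] s) (𝓝 r)) :
    ∃ g : ℂ → ℂ, DifferentiableOn ℂ g U ∧ ∀ z ≠ s, g z = f z - r * (z - s)⁻¹ := by
  set h : ℂ → ℂ := update (fun z => (z - s) * f z) s r
  have hh : DifferentiableOn ℂ h U := by
    refine (Complex.differentiableOn_compl_singleton_and_continuousAt_iff hU).1
      ⟨?_, continuousAt_update_same.2 hlim⟩
    exact ((by fun_prop : DifferentiableOn ℂ (fun z => z - s) (U \ {s})).mul hf).congr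
      fun z hz => update_of_ne hz.2 _ _
  refine ⟨dslope h s, (Complex.differentiableOn_dslope hU).2 hh, fun z hz => ?_⟩
  have hne : z - s ≠ 0 := sub_ne_zero.2 hz
  have hs : h s = r := update_self (f := fun z => (z - s) * f z) ..
  have hz' : h z = (z - s) * f z := update_of_ne hz _ _
  rw [dslope_of_ne _ hz, slope_def_field, hs, hz']
  field_simp

theorem exists_differentiableOn_sub_sum_simple_poles {U : Set ℂ} (hU : IsOpen U) {F : Finset ℂ}
    (hFU : (F : Set ℂ) ⊆ U) {f r : ℂ → ℂ} (hf : DifferentiableOn ℂ f (U \ F))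
    (hlim : ∀ s ∈ F, Tendsto (fun z => (z - s) * f z) (𝓝[≠] s) (𝓝 (r s))) :
    ∃ g : ℂ → ℂ, DifferentiableOn ℂ g U ∧
      ∀ z ∉ F, g z = f z - ∑ s ∈ F, r s * (z - s)⁻¹ := by
  classical
  induction F using Finset.induction generalizing f with
  | empty => exact ⟨f, by simpa using hf, by simp⟩
  | insert s F hsF ih =>
    rw [Finset.coe_insert, insert_subset_iff] at hFU
    rw [Finset.coe_insert, ← union_singleton, ← sdiff_sdiff] at hf
    obtain ⟨f₁, hf₁, hf₁_eq⟩ := exists_differentiableOn_sub_simple_pole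
      ((hU.sdiff F.finite_toSet.isClosed).mem_nhds ⟨hFU.1, hsF⟩) hf
      (hlim s (Finset.mem_insert_self s F))
    have hlim₁ : ∀ v ∈ F, Tendsto (fun z => (z - v) * f₁ z) (𝓝[≠] v) (𝓝 (r v)) := by
      intro v hv
      have hvs : v ≠ s := fun h => hsF (h ▸ hv)
      have hpole : ContinuousAt (fun z => (z - v) * (r s * (z - s)⁻¹)) v := by
        fun_prop (disch := exact sub_ne_zero.2 hvs)
      have h := (hlim v (Finset.mem_insert_of_mem hv)).sub
        (hpole.tendsto.mono_left nhdsWithin_le_nhds)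
      rw [sub_self, zero_mul, sub_zero] at h
      refine h.congr' ?_
      filter_upwards [nhdsWithin_le_nhds (isOpen_ne.mem_nhds hvs)] with z hz
      rw [hf₁_eq z hz, mul_sub]
    obtain ⟨g, hg, hg_eq⟩ := ih hFU.2 hf₁ hlim₁
    refine ⟨g, hg, fun z hz => ?_⟩
    rw [Finset.mem_insert, not_or] at hz
    rw [hg_eq z hz.2, hf₁_eq z hz.1, Finset.sum_insert hsF, sub_sub]

end Residues

namespace Contour

theorem integral_sub_sum_simple_poles (C : Contour) {F : Finset ℂ} {f r : ℂ → ℂ}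
    (hf : ContinuousOn f C.support) (hF : ∀ s ∈ F, s ∉ C.support) :
    C.integral (fun z => f z - ∑ s ∈ F, r s * (z - s)⁻¹) =
      C.integral f - 2 * Real.pi * Complex.I * ∑ s ∈ F, C.winding s * r s := by
  have hpole : ∀ s ∈ F, ContinuousOn (fun z => r s * (z - s)⁻¹) C.support := fun s hs =>
    continuousOn_const.mul (continuousOn_inv_sub (hF s hs))
  rw [C.integral_sub hf (continuousOn_finsetSum F hpole), C.integral_finset_sum F hpole,
    Finset.mul_sum]
  congr 1
  refine Finset.sum_congr rfl fun s _ => ?_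
  rw [integral_const_mul, integral_inv_sub]
  ring

theorem integral_sub_integral_eq_sum_residues (C C' : Contour) {U : Set ℂ} (hU : IsOpen U)
    {F : Finset ℂ} (hFU : (F : Set ℂ) ⊆ U) {f r : ℂ → ℂ} (hf : DifferentiableOn ℂ f (U \ F))
    (hlim : ∀ s ∈ F, Tendsto (fun z => (z - s) * f z) (𝓝[≠] s) (𝓝 (r s)))
    (hC : C.support ⊆ U \ F) (hC' : C'.support ⊆ U \ F)
    (hwind : ∀ z ∉ U, C.winding z = C'.winding z) :
    C.integral f - C'.integral f =
      2 * Real.pi * Complex.I * ∑ s ∈ F, (C.winding s - C'.winding s) * r s := by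
  obtain ⟨g, hg, hg_eq⟩ := exists_differentiableOn_sub_sum_simple_poles hU hFU hf hlim
  have hintegral : ∀ D : Contour, D.support ⊆ U \ F → D.integral g =
      D.integral f - 2 * Real.pi * Complex.I * ∑ s ∈ F, D.winding s * r s := fun D hD => by
    rw [← D.integral_sub_sum_simple_poles (hf.continuousOn.mono hD) fun s hs hsD => (hD hsD).2 hs]
    exact D.integral_congr fun z hz => hg_eq z (hD hz).2
  have h := C.integral_eq_of_winding_eq C' hU hg (hC.trans sdiff_subset) (hC'.trans sdiff_subset)
    hwind
  rw [hintegral C hC, hintegral C' hC'] at h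
  simp only [sub_mul, Finset.sum_sub_distrib]
  linear_combination h

end Contour

theorem hasDerivAt_circleMap_two_pi_mul (c : ℂ) (r s : ℝ) :
    HasDerivAt (fun s : ℝ => circleMap c r (2 * Real.pi * s))
      ((2 * Real.pi) • deriv (circleMap c r) (2 * Real.pi * s)) s := by
  have h : HasDerivAt (fun s : ℝ => circleMap c r (2 * Real.pi * s)) _ s :=
    (differentiable_circleMap c r (2 * Real.pi * s)).hasDerivAt.scomp s
      ((hasDerivAt_id s).const_mul (2 * Real.pi))
  simpa using h

/-- The circle with centre `c` and radius `r`, traversed once counterclockwise. -/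
noncomputable def ClosedCurve.circle (c : ℂ) (r : ℝ) : ClosedCurve where
  toFun s := circleMap c r (2 * Real.pi * s)
  continuousOn := by fun_prop
  closed := by simpa using (periodic_circleMap c r 0).symm
  breaks := ∅
  differentiableAt s _ := (hasDerivAt_circleMap_two_pi_mul c r s).differentiableAt
  continuousOn_deriv := by
    simp only [funext fun s => (hasDerivAt_circleMap_two_pi_mul c r s).deriv, deriv_circleMap]
    fun_prop
  integrable_deriv := by
    simp only [funext fun s => (hasDerivAt_circleMap_two_pi_mul c r s).deriv, deriv_circleMap]
    exact Continuous.intervalIntegrable (by fun_prop) _ _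

theorem ClosedCurve.integral_circle (c : ℂ) (r : ℝ) (f : ℂ → ℂ) :
    (ClosedCurve.circle c r).integral f = ∮ z in C(c, r), f z := by
  have h := intervalIntegral.smul_integral_comp_mul_left
    (fun θ => deriv (circleMap c r) θ • f (circleMap c r θ)) (2 * Real.pi) (a := 0) (b := 1)
  rw [mul_zero, mul_one] at h
  rw [circleIntegral, ← h, ← intervalIntegral.integral_smul]
  refine intervalIntegral.integral_congr fun s _ => ?_
  simp only [circle, (hasDerivAt_circleMap_two_pi_mul c r s).deriv, smul_eq_mul,
    Complex.real_smul]
  ring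

namespace Contour

/-- The contour consisting of one circle, traversed once counterclockwise. -/
noncomputable def circle (c : ℂ) (r : ℝ) : Contour := [ClosedCurve.circle c r]

theorem integral_circle (c : ℂ) (r : ℝ) (f : ℂ → ℂ) :
    (circle c r).integral f = ∮ z in C(c, r), f z := by
  rw [circle, integral_cons, integral_nil, add_zero, ClosedCurve.integral_circle]

theorem support_circle_subset {c : ℂ} {r : ℝ} (hr : 0 ≤ r) :
    (circle c r).support ⊆ sphere c r := by
  rw [circle, support_cons, support_nil, union_empty]
  rintro _ ⟨s, _, rfl⟩
  exact circleMap_mem_sphere c hr _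

theorem winding_circle_of_mem_ball {c w : ℂ} {r : ℝ} (hw : w ∈ ball c r) :
    (circle c r).winding w = 1 := by
  rw [Contour.winding, integral_circle, circleIntegral.integral_sub_inv_of_mem_ball hw,
    inv_mul_cancel₀ Complex.two_pi_I_ne_zero]

theorem winding_circle_of_notMem_closedBall {c w : ℂ} {r : ℝ} (hr : 0 ≤ r)
    (hw : w ∉ closedBall c r) : (circle c r).winding w = 0 := by
  have hd : DifferentiableOn ℂ (fun z => (z - w)⁻¹) (closedBall c r) :=
    DifferentiableOn.inv (by fun_prop) fun z hz h => hw (sub_eq_zero.1 h ▸ hz)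
  rw [Contour.winding, integral_circle, mul_eq_zero]
  exact Or.inr ((hd.mono closure_ball_subset_closedBall).diffContOnCl.circleIntegral_eq_zero hr)

theorem separates_circle {c : ℂ} {r : ℝ} (hr : 0 ≤ r) {I O : Set ℂ} (hI : I ⊆ ball c r)
    (hO : Disjoint O (closedBall c r)) : (circle c r).Separates I O := by
  refine ⟨fun w hw => ⟨fun h => ?_, winding_circle_of_mem_ball (hI hw)⟩, fun w hw => ?_⟩
  · exact (mem_ball.1 (hI hw)).ne (support_circle_subset hr h)
  · have hw' := disjoint_left.1 hO hw
    exact ⟨fun h => hw' (sphere_subset_closedBall (support_circle_subset hr h)),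
      winding_circle_of_notMem_closedBall hr hw'⟩

theorem Separates.append {C C' : Contour} {I I' O : Set ℂ} (hC : C.Separates I (I' ∪ O))
    (hC' : C'.Separates I' (I ∪ O)) : Contour.Separates (C ++ C') (I ∪ I') O := by
  simp only [Contour.Separates, support_append, winding_append, mem_union, not_or]
  refine ⟨?_, fun w hw => ⟨⟨(hC.2 w (Or.inr hw)).1, (hC'.2 w (Or.inr hw)).1⟩, ?_⟩⟩
  · rintro w (hw | hw)
    · exact ⟨⟨(hC.1 w hw).1, (hC'.2 w (Or.inl hw)).1⟩, by
        rw [(hC.1 w hw).2, (hC'.2 w (Or.inl hw)).2, add_zero]⟩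
    · exact ⟨⟨(hC.2 w (Or.inl hw)).1, (hC'.1 w hw).1⟩, by
        rw [(hC.2 w (Or.inl hw)).2, (hC'.1 w hw).2, zero_add]⟩
  · rw [(hC.2 w (Or.inr hw)).2, (hC'.2 w (Or.inr hw)).2, add_zero]

theorem Separates.exists_insert {C : Contour} {I O : Set ℂ} {w : ℂ}
    (hC : C.Separates I (insert w O)) (hw : w ∉ closure (I ∪ O)) :
    ∃ C' : Contour, C'.Separates (insert w I) O := by
  obtain ⟨δ, hδ, hsub⟩ :=
    nhds_basis_closedBall.mem_iff.1 (isClosed_closure.isOpen_compl.mem_nhds hw)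
  rw [← singleton_union] at hC
  refine ⟨C ++ circle w δ, ?_⟩
  rw [← union_singleton]
  refine hC.append (separates_circle hδ.le (singleton_subset_iff.2 (mem_ball_self hδ)) ?_)
  exact disjoint_left.2 fun v hv hvδ => hsub hvδ (subset_closure hv)

theorem Separates.exists_union_finite {C : Contour} {I O F : Set ℂ} (hF : F.Finite)
    (hC : C.Separates I (F ∪ O)) (hFIO : ∀ w ∈ F, w ∉ closure (I ∪ O)) :
    ∃ C' : Contour, C'.Separates (I ∪ F) O := by
  induction F, hF using Set.Finite.induction_on generalizing O with
  | empty => exact ⟨C, by simpa using hC⟩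
  | @insert w F hwF hF ih =>
    obtain ⟨hw, hFIO⟩ := forall_mem_insert.1 hFIO
    rw [insert_union, ← union_insert] at hC
    obtain ⟨C', hC'⟩ := ih hC fun v hv => by
      rw [union_insert, ← singleton_union, closure_union, closure_singleton, mem_union, not_or]
      exact ⟨fun h => hwF (h ▸ hv), hFIO v hv⟩
    rw [union_insert]
    refine hC'.exists_insert ?_
    rw [union_right_comm, closure_union, hF.isClosed.closure_eq, mem_union, not_or]
    exact ⟨hw, hwF⟩

theorem isClosed_of_finite_setOf_norm_le {O : Set ℂ} (hO : ∀ R, {w ∈ O | ‖w‖ ≤ R}.Finite) :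
    IsClosed O := by
  rw [← isOpen_compl_iff, isOpen_iff_mem_nhds]
  intro z hz
  filter_upwards [(hO (‖z‖ + 1)).isClosed.isOpen_compl.mem_nhds fun h => hz h.1,
    continuous_norm.continuousAt.eventually (eventually_le_nhds (lt_add_one ‖z‖))] with w hw hwz hwO
  exact hw ⟨hwO, hwz⟩

/-- A small circle about the origin encloses all but finitely many points of `I`; small circles
about the remaining points are added to it. -/
theorem exists_separates {I O : Set ℂ} (hI : ∀ r > 0, {w ∈ I | r ≤ ‖w‖}.Finite)
    (hO : ∀ R, {w ∈ O | ‖w‖ ≤ R}.Finite) (h0 : 0 ∉ O) (hdisj : Disjoint I O) :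
    ∃ C : Contour, C.Separates I O := by
  have hOclosed := isClosed_of_finite_setOf_norm_le hO
  obtain ⟨r₀, hr₀, hr₀O⟩ := Metric.isOpen_iff.1 hOclosed.isOpen_compl 0 h0
  obtain ⟨r, ⟨hr, hrr₀⟩, hrI⟩ := (Ioo_infinite (half_lt_self hr₀)).exists_notMem_finite
    ((hI (r₀ / 2) (half_pos hr₀)).image norm)
  have hrpos : 0 < r := (half_pos hr₀).trans hr
  have hIr : ∀ w ∈ I, r ≤ ‖w‖ → r < ‖w‖ := fun w hw hrw =>
    hrw.lt_of_ne fun h => hrI ⟨w, ⟨hw, h ▸ hr.le⟩, h.symm⟩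
  have hcircle : (circle 0 r).Separates (I ∩ ball 0 r) ({w ∈ I | r ≤ ‖w‖} ∪ O) := by
    refine separates_circle hrpos.le inter_subset_right (disjoint_union_left.2 ⟨?_, ?_⟩)
    · exact disjoint_left.2 fun w hw hwr => (hIr w hw.1 hw.2).not_ge (mem_closedBall_zero_iff.1 hwr)
    · exact disjoint_left.2 fun w hw hwr => hr₀O (closedBall_subset_ball hrr₀ hwr) hw
  obtain ⟨C, hC⟩ := hcircle.exists_union_finite (hI r hrpos) fun w hw => by
    rw [closure_union, hOclosed.closure_eq, mem_union, not_or]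
    refine ⟨fun h => (hIr w hw.1 hw.2).not_ge (mem_closedBall_zero_iff.1 ?_),
      disjoint_left.1 hdisj hw.1⟩
    exact closure_ball_subset_closedBall (closure_mono inter_subset_right h)
  refine ⟨C, fun w hw => hC.1 w ?_, hC.2⟩
  rcases lt_or_ge ‖w‖ r with h | h
  · exact Or.inl ⟨hw, mem_ball_zero_iff.2 h⟩
  · exact Or.inr ⟨hw, h⟩

end Contour

section InfiniteProducts

variable {ι : Type*} {c : ι → ℂ}

theorem multipliable_one_sub_mul (hc : Summable fun i => ‖c i‖) (z : ℂ) :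
    Multipliable fun i => 1 - z * c i := by
  simp_rw [sub_eq_add_neg]
  refine multipliable_one_add_of_summable ?_
  simpa using hc.mul_left ‖z‖

theorem tprod_one_sub_mul_eq_zero_iff (hc : Summable fun i => ‖c i‖) (z : ℂ) :
    ∏' i, (1 - z * c i) = 0 ↔ ∃ i, z * c i = 1 := by
  refine ⟨fun h => ?_, fun ⟨i, hi⟩ => tprod_of_exists_eq_zero ⟨i, by rw [hi, sub_self]⟩⟩
  by_contra! hne
  refine tprod_one_add_ne_zero_of_summable (f := fun i => -(z * c i)) (fun i hi => hne i ?_) ?_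
    (by simpa only [← sub_eq_add_neg] using h)
  · linear_combination -hi
  · simpa using hc.mul_left ‖z‖

theorem differentiable_tprod_one_sub_mul (hc : Summable fun i => ‖c i‖) :
    Differentiable ℂ fun z => ∏' i, (1 - z * c i) := by
  intro z
  have hball : IsOpen (Metric.ball (0 : ℂ) (‖z‖ + 1)) := Metric.isOpen_ball
  have h := Summable.hasProdLocallyUniformlyOn_one_add (f := fun i z => -(z * c i)) hball
    (hc.mul_left (‖z‖ + 1)) (Eventually.of_forall fun i w hw => ?_) fun i => by fun_prop
  · simp_rw [← sub_eq_add_neg] at h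
    refine (h.differentiableOn (.of_forall fun s => ?_) hball).differentiableAt
      (hball.mem_nhds (by simp))
    simpa [Finset.prod_fn] using DifferentiableOn.finsetProd (fun _ _ => by fun_prop)
  · rw [mem_ball_zero_iff] at hw
    rw [norm_neg, norm_mul]
    exact mul_le_mul_of_nonneg_right hw.le (norm_nonneg _)

end InfiniteProducts

section QPochhammer

variable {p q : ℂ}

theorem summable_norm_pow (hq : ‖q‖ < 1) : Summable fun j : ℕ => ‖q ^ j‖ := by
  simpa using summable_geometric_of_lt_one (norm_nonneg q) hq

theorem qPochInf_eq_zero_iff (hq : ‖q‖ < 1) (z : ℂ) :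
    qPochInf z q = 0 ↔ ∃ j : ℕ, z * q ^ j = 1 :=
  tprod_one_sub_mul_eq_zero_iff (summable_norm_pow hq) z

theorem differentiable_qPochInf (hq : ‖q‖ < 1) : Differentiable ℂ fun z => qPochInf z q :=
  differentiable_tprod_one_sub_mul (summable_norm_pow hq)

theorem qPochInf_eq_mul (hq : ‖q‖ < 1) (z : ℂ) :
    qPochInf z q = (1 - z) * qPochInf (z * q) q := by
  have h : ∀ j : ℕ, 1 - z * q ^ (j + 1) = 1 - z * q * q ^ j := fun j => by ring
  rw [qPochInf, tprod_eq_zero_mul', qPochInf]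
  · simp only [h, pow_zero, mul_one]
  · simp only [h]
    exact multipliable_one_sub_mul (summable_norm_pow hq) (z * q)

theorem qPochInf_self_ne_zero (hq : ‖q‖ < 1) : qPochInf q q ≠ 0 := by
  rw [Ne, qPochInf_eq_zero_iff hq]
  rintro ⟨j, hj⟩
  rw [← pow_succ'] at hj
  have h := pow_lt_one₀ (norm_nonneg q) hq (Nat.succ_ne_zero j)
  rw [← norm_pow, Nat.succ_eq_add_one, hj, norm_one] at h
  exact h.false

/-- The double infinite product `∏_{i, j ≥ 0} (1 - z p^i q^j)`. -/
noncomputable def doublePochInf (p q z : ℂ) : ℂ := ∏' jk : ℕ × ℕ, (1 - z * p ^ jk.1 * q ^ jk.2)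

theorem summable_norm_pow_mul_pow (hp : ‖p‖ < 1) (hq : ‖q‖ < 1) :
    Summable fun jk : ℕ × ℕ => ‖p ^ jk.1 * q ^ jk.2‖ :=
  (summable_norm_pow hp).mul_norm (summable_norm_pow hq)

theorem doublePochInf_eq (p q z : ℂ) :
    doublePochInf p q z = ∏' jk : ℕ × ℕ, (1 - z * (p ^ jk.1 * q ^ jk.2)) := by
  simp only [doublePochInf, mul_assoc]

theorem doublePochInf_eq_zero_iff (hp : ‖p‖ < 1) (hq : ‖q‖ < 1) (z : ℂ) :
    doublePochInf p q z = 0 ↔ ∃ i j : ℕ, z * p ^ i * q ^ j = 1 := by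
  rw [doublePochInf_eq, tprod_one_sub_mul_eq_zero_iff (summable_norm_pow_mul_pow hp hq),
    Prod.exists]
  simp only [mul_assoc]

theorem doublePochInf_ne_zero (hp : ‖p‖ < 1) (hq : ‖q‖ < 1) {z : ℂ}
    (hz : ∀ i j : ℕ, z * q ^ i * p ^ j ≠ 1) : doublePochInf p q z ≠ 0 := by
  rw [Ne, doublePochInf_eq_zero_iff hp hq]
  rintro ⟨i, j, h⟩
  exact hz j i (by rw [← h]; ring)

theorem norm_pow_mul_pow_le_one (hp : ‖p‖ < 1) (hq : ‖q‖ < 1) (i j : ℕ) :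
    ‖q ^ i * p ^ j‖ ≤ 1 := by
  rw [norm_mul, norm_pow, norm_pow]
  exact mul_le_one₀ (pow_le_one₀ (norm_nonneg _) hq.le) (by positivity)
    (pow_le_one₀ (norm_nonneg _) hp.le)

theorem mul_pow_mul_pow_ne_one_of_norm_lt_one (hp : ‖p‖ < 1) (hq : ‖q‖ < 1) {z : ℂ}
    (hz : ‖z‖ < 1) (i j : ℕ) : z * q ^ i * p ^ j ≠ 1 := by
  intro h
  have h1 : ‖z‖ * ‖q ^ i * p ^ j‖ = 1 := by rw [← norm_mul, ← mul_assoc, h, norm_one]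
  nlinarith [norm_pow_mul_pow_le_one hp hq i j, norm_nonneg z, norm_nonneg (q ^ i * p ^ j)]

theorem doublePochInf_ne_zero_of_norm_lt_one (hp : ‖p‖ < 1) (hq : ‖q‖ < 1) {z : ℂ}
    (hz : ‖z‖ < 1) : doublePochInf p q z ≠ 0 :=
  doublePochInf_ne_zero hp hq (mul_pow_mul_pow_ne_one_of_norm_lt_one hp hq hz)

theorem differentiable_doublePochInf (hp : ‖p‖ < 1) (hq : ‖q‖ < 1) :
    Differentiable ℂ (doublePochInf p q) := by
  rw [funext (doublePochInf_eq p q)]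
  exact differentiable_tprod_one_sub_mul (summable_norm_pow_mul_pow hp hq)

theorem doublePochInf_comm (p q z : ℂ) : doublePochInf p q z = doublePochInf q p z := by
  rw [doublePochInf_eq, doublePochInf_eq, ← (Equiv.prodComm ℕ ℕ).tprod_eq]
  simp [mul_comm]

theorem doublePochInf_eq_mul (hp : ‖p‖ < 1) (hq : ‖q‖ < 1) (z : ℂ) :
    doublePochInf p q z = qPochInf z p * doublePochInf p q (z * q) := by
  have hrow : ∀ (w : ℂ) (i : ℕ), Multipliable fun j : ℕ => 1 - w * (p ^ i * q ^ j) := fun w i => by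
    simpa only [mul_assoc] using multipliable_one_sub_mul (summable_norm_pow hq) (w * p ^ i)
  have hprod : ∀ w, HasProd (fun i => ∏' j, (1 - w * (p ^ i * q ^ j))) (doublePochInf p q w) :=
    fun w => by
      rw [doublePochInf_eq]
      exact (multipliable_one_sub_mul (summable_norm_pow_mul_pow hp hq) w).hasProd.prod_fiberwise
        fun i => (hrow w i).hasProd
  refine (hprod z).unique ?_
  have h := (multipliable_one_sub_mul (summable_norm_pow hp) z).hasProd.mul (hprod (z * q))
  refine h.congr_fun fun i => ?_
  have hs : ∀ j : ℕ, 1 - z * (p ^ i * q ^ (j + 1)) = 1 - z * q * (p ^ i * q ^ j) := fun j => by ring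
  rw [tprod_eq_zero_mul']
  · simp only [hs, pow_zero, mul_one]
  · simp only [hs]
    exact hrow (z * q) i

theorem doublePochInf_eq_mul' (hp : ‖p‖ < 1) (hq : ‖q‖ < 1) (z : ℂ) :
    doublePochInf p q z = qPochInf z q * doublePochInf p q (z * p) := by
  rw [doublePochInf_comm, doublePochInf_eq_mul hq hp, doublePochInf_comm q p]

end QPochhammer

section Theta

variable {p : ℂ}

theorem theta_inv (hp : ‖p‖ < 1) {z : ℂ} (hz : z ≠ 0) : theta z⁻¹ p = -z⁻¹ * theta z p := by
  rw [theta, theta, qPochInf_eq_mul hp z, qPochInf_eq_mul hp z⁻¹, inv_inv, mul_comm p z,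
    mul_comm z⁻¹ p]
  field_simp
  ring

theorem theta_ne_zero (hp : ‖p‖ < 1) {z : ℂ} (hz : z ≠ 0) (h1 : ∀ j : ℕ, z * p ^ j ≠ 1)
    (h2 : ∀ j : ℕ, z ≠ p ^ j) : theta z p ≠ 0 := by
  refine mul_ne_zero ?_ ?_
  · rw [Ne, qPochInf_eq_zero_iff hp]
    exact fun ⟨j, hj⟩ => h1 j hj
  · rw [Ne, qPochInf_eq_zero_iff hp]
    rintro ⟨j, hj⟩
    refine h2 (j + 1) ?_
    field_simp at hj
    rw [← hj]
    ring

theorem theta_ne_zero_of_norm_lt_one (hp : ‖p‖ < 1) {z : ℂ} (hz : z ≠ 0) (hz1 : ‖z‖ < 1)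
    (h : ∀ j : ℕ, z ≠ p ^ j) : theta z p ≠ 0 :=
  theta_ne_zero hp hz (fun j => by
    simpa using mul_pow_mul_pow_ne_one_of_norm_lt_one hp hp hz1 0 j) h

theorem theta_one (hp : ‖p‖ < 1) : theta 1 p = 0 := by
  rw [theta, (qPochInf_eq_zero_iff hp 1).2 ⟨0, by simp⟩, zero_mul]

theorem continuousAt_theta (hp : ‖p‖ < 1) {z : ℂ} (hz : z ≠ 0) :
    ContinuousAt (fun z => theta z p) z :=
  ((differentiable_qPochInf hp).continuous.continuousAt).mul
    ((differentiable_qPochInf hp).continuous.continuousAt.comp (f := fun z => p * z⁻¹)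
      (continuousAt_const.mul (continuousAt_inv₀ hz)))

end Theta

section EllipticGamma

variable {p q : ℂ}

theorem ellPoch_natCast (p q z : ℂ) (n : ℕ) :
    ellPoch p q z n = ∏ j ∈ Finset.range n, theta (z * q ^ j) p := rfl

theorem ellGamma_eq (p q z : ℂ) :
    ellGamma p q z = doublePochInf p q (p * q * z⁻¹) / doublePochInf p q z := by
  have h : ∀ jk : ℕ × ℕ, 1 - z⁻¹ * p ^ (jk.1 + 1) * q ^ (jk.2 + 1) =
      1 - p * q * z⁻¹ * p ^ jk.1 * q ^ jk.2 := fun jk => by ring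
  rw [ellGamma, tprod_congr h]
  rfl

theorem ellGamma_ne_zero (hp : ‖p‖ < 1) (hq : ‖q‖ < 1) {z : ℂ} (hz : z ≠ 0)
    (h1 : ∀ i j : ℕ, z * q ^ i * p ^ j ≠ 1)
    (h2 : ∀ i j : ℕ, z ≠ q ^ (i + 1) * p ^ (j + 1)) : ellGamma p q z ≠ 0 := by
  rw [ellGamma_eq]
  refine div_ne_zero (doublePochInf_ne_zero hp hq fun i j h => h2 i j ?_)
    (doublePochInf_ne_zero hp hq h1)
  field_simp at h
  rw [← h]
  ring

theorem differentiableAt_ellGamma (hp : ‖p‖ < 1) (hq : ‖q‖ < 1) {z : ℂ} (hz : z ≠ 0)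
    (h : ∀ i j : ℕ, z * q ^ i * p ^ j ≠ 1) : DifferentiableAt ℂ (ellGamma p q) z := by
  rw [funext (ellGamma_eq p q)]
  exact ((differentiable_doublePochInf hp hq).differentiableAt.comp z
    (f := fun z => p * q * z⁻¹) ((differentiableAt_inv hz).const_mul _)).fun_div
    (differentiable_doublePochInf hp hq).differentiableAt (doublePochInf_ne_zero hp hq h)

theorem ellGamma_mul (hp : ‖p‖ < 1) (hq : ‖q‖ < 1) (hq0 : q ≠ 0) {z : ℂ}
    (hz : ∀ j : ℕ, z * p ^ j ≠ 1) : ellGamma p q (z * q) = theta z p * ellGamma p q z := by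
  have hz' : qPochInf z p ≠ 0 := by
    rw [Ne, qPochInf_eq_zero_iff hp]
    exact fun ⟨j, hj⟩ => hz j hj
  have hn : p * q * (z * q)⁻¹ = p * z⁻¹ := by
    rw [mul_inv]
    field_simp
  have hn' : p * z⁻¹ * q = p * q * z⁻¹ := by ring
  rw [ellGamma_eq, ellGamma_eq, hn, doublePochInf_eq_mul hp hq (p * z⁻¹), hn',
    doublePochInf_eq_mul hp hq z, theta]
  field_simp

theorem ellGamma_mul_pow (hp : ‖p‖ < 1) (hq : ‖q‖ < 1) (hq0 : q ≠ 0) {z : ℂ}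
    (hz : ∀ i j : ℕ, z * q ^ i * p ^ j ≠ 1) (n : ℕ) :
    ellGamma p q (z * q ^ n) = ellPoch p q z n * ellGamma p q z := by
  simp only [ellPoch_natCast]
  induction n with
  | zero => simp
  | succ n ih =>
    rw [pow_succ, ← mul_assoc, ellGamma_mul hp hq hq0 (hz n), ih, Finset.prod_range_succ]
    ring

theorem tendsto_one_sub_mul_ellGamma (hp : ‖p‖ < 1) (hq : ‖q‖ < 1) :
    Tendsto (fun ε => (1 - ε) * ellGamma p q ε) (𝓝[≠] 1)
      (𝓝 (qPochInf p p * qPochInf q q)⁻¹) := by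
  have hpq : ‖p * q‖ < 1 := by
    rw [norm_mul]
    exact mul_lt_one_of_nonneg_of_lt_one_left (norm_nonneg _) hp hq.le
  have hE : doublePochInf p q (p * q) ≠ 0 := doublePochInf_ne_zero_of_norm_lt_one hp hq hpq
  have hEq : doublePochInf p q q ≠ 0 := doublePochInf_ne_zero_of_norm_lt_one hp hq hq
  have hcont : ContinuousAt (fun ε => doublePochInf p q (p * q * ε⁻¹) /
      (qPochInf (ε * p) p * doublePochInf p q (ε * q))) 1 := by
    refine ContinuousAt.div ?_ ?_ ?_
    · exact (differentiable_doublePochInf hp hq).continuous.continuousAt.comp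
        (f := fun ε => p * q * ε⁻¹) (continuousAt_const.mul (continuousAt_inv₀ one_ne_zero))
    · have h1 := (differentiable_qPochInf hp).continuous
      have h2 := (differentiable_doublePochInf hp hq).continuous
      exact ((h1.comp (continuous_mul_const p)).mul (h2.comp (continuous_mul_const q))).continuousAt
    · rw [one_mul, one_mul]
      exact mul_ne_zero (qPochInf_self_ne_zero hp) hEq
  have hval : doublePochInf p q (p * q * 1⁻¹) /
      (qPochInf (1 * p) p * doublePochInf p q (1 * q)) = (qPochInf p p * qPochInf q q)⁻¹ := by
    have h := doublePochInf_eq_mul' hp hq q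
    rw [mul_comm q p] at h
    rw [inv_one, mul_one, one_mul, one_mul, h]
    have := qPochInf_self_ne_zero hp
    have := qPochInf_self_ne_zero hq
    field_simp
  have ht := hcont.tendsto.mono_left (nhdsWithin_le_nhds (s := {1}ᶜ))
  rw [hval] at ht
  refine ht.congr' ?_
  filter_upwards [self_mem_nhdsWithin] with ε hε
  have h1 : 1 - ε ≠ 0 := sub_ne_zero.2 (Ne.symm hε)
  rw [ellGamma_eq, doublePochInf_eq_mul hp hq ε, qPochInf_eq_mul hp ε]
  rw [mul_assoc (1 - ε), ← mul_div_assoc, mul_div_mul_left _ _ h1]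

/-- The analytic continuation of `1 / (Γ(w) Γ(1 / w))` to the punctured plane. -/
noncomputable def gammaReflection (p q w : ℂ) : ℂ :=
  (qPochInf w p * qPochInf (w * q) q) * (qPochInf w⁻¹ p * qPochInf (w⁻¹ * q) q)

theorem gammaReflection_inv (p q w : ℂ) : gammaReflection p q w⁻¹ = gammaReflection p q w := by
  rw [gammaReflection, gammaReflection, inv_inv, mul_comm]

theorem doublePochInf_eq_mul_mul (hp : ‖p‖ < 1) (hq : ‖q‖ < 1) (w : ℂ) :
    doublePochInf p q w =
      qPochInf w p * qPochInf (w * q) q * doublePochInf p q (p * q * w) := by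
  rw [doublePochInf_eq_mul hp hq w, doublePochInf_eq_mul' hp hq (w * q),
    show w * q * p = p * q * w by ring]
  ring

theorem inv_ellGamma_mul_ellGamma_inv (hp : ‖p‖ < 1) (hq : ‖q‖ < 1) {w : ℂ}
    (h1 : doublePochInf p q (p * q * w) ≠ 0) (h2 : doublePochInf p q (p * q * w⁻¹) ≠ 0) :
    (ellGamma p q w * ellGamma p q w⁻¹)⁻¹ = gammaReflection p q w := by
  rw [ellGamma_eq, ellGamma_eq, inv_inv, div_mul_div_comm, inv_div,
    doublePochInf_eq_mul_mul hp hq w, doublePochInf_eq_mul_mul hp hq w⁻¹, gammaReflection,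
    div_eq_iff (mul_ne_zero h2 h1)]
  ring

theorem differentiableAt_gammaReflection (hp : ‖p‖ < 1) (hq : ‖q‖ < 1) {w : ℂ} (hw : w ≠ 0) :
    DifferentiableAt ℂ (gammaReflection p q) w := by
  have h1 := differentiable_qPochInf hp
  have h2 := differentiable_qPochInf hq
  have hi : DifferentiableAt ℂ (fun w : ℂ => w⁻¹) w := differentiableAt_inv hw
  exact (h1.differentiableAt.mul (h2.differentiableAt.comp w (f := fun w => w * q)
    (by fun_prop))).mul ((h1.differentiableAt.comp w (f := fun w => w⁻¹) hi).mul
      (h2.differentiableAt.comp w (f := fun w => w⁻¹ * q) (hi.mul_const q)))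

end EllipticGamma

section Kernel

variable {p q : ℂ}

/-- The kernel of the elliptic Fourier transform, continued analytically to the zeros of
`Γ(z^{±2})`. -/
noncomputable def regKernel (p q t x z : ℂ) : ℂ :=
  ellGamma p q (t * x * z) * ellGamma p q (t * x * z⁻¹) *
      ellGamma p q (t * x⁻¹ * z) * ellGamma p q (t * x⁻¹ * z⁻¹) *
    (gammaReflection p q (z ^ 2) / ellGamma p q (t ^ 2))

theorem regKernel_inv (p q t x z : ℂ) : regKernel p q t x z⁻¹ = regKernel p q t x z := by
  rw [regKernel, regKernel, inv_inv, inv_pow, gammaReflection_inv]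
  ring

theorem countable_setOf_sq_mem {D : Set ℂ} (hD : D.Countable) : {z : ℂ | z ^ 2 ∈ D}.Countable := by
  have h : (⋃ w ∈ D, {z : ℂ | z ^ 2 = w}).Countable := by
    refine hD.biUnion fun w _ => ?_
    obtain ⟨s, hs⟩ := IsAlgClosed.exists_pow_nat_eq w two_pos
    refine (Set.toFinite {s, -s}).countable.mono fun z hz => ?_
    exact sq_eq_sq_iff_eq_or_eq_neg.1 (hz.trans hs.symm)
  exact h.mono fun z hz => Set.mem_iUnion₂.2 ⟨z ^ 2, hz, rfl⟩

/-- The points at which `kernel` need not have the value of its analytic continuation. -/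
noncomputable def kernelExceptional (p q : ℂ) : Set ℂ :=
  {z | doublePochInf p q (p * q * z ^ 2) = 0 ∨ doublePochInf p q (p * q * z⁻¹ ^ 2) = 0}

theorem countable_kernelExceptional (hp : ‖p‖ < 1) (hq : ‖q‖ < 1) :
    (kernelExceptional p q).Countable := by
  have hD : {w : ℂ | doublePochInf p q (p * q * w) = 0}.Countable := by
    refine (Set.countable_range fun ij : ℕ × ℕ => (p * q * p ^ ij.1 * q ^ ij.2)⁻¹).mono
      fun w hw => ?_
    obtain ⟨i, j, h⟩ := (doublePochInf_eq_zero_iff hp hq _).1 hw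
    refine ⟨(i, j), (eq_inv_of_mul_eq_one_right ?_).symm⟩
    rw [← h]
    ring
  have h2 := countable_setOf_sq_mem hD
  exact h2.union (h2.preimage inv_injective)

theorem kernel_eq_regKernel_of_notMem (hp : ‖p‖ < 1) (hq : ‖q‖ < 1) (t x : ℂ) {z : ℂ}
    (hz : z ∉ kernelExceptional p q) : kernel p q t x z = regKernel p q t x z := by
  obtain ⟨h1, h2⟩ := not_or.1 hz
  rw [inv_pow] at h2
  rw [kernel, regKernel, ← inv_ellGamma_mul_ellGamma_inv hp hq h1 h2, inv_pow]
  ring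

theorem mul_pow_mul_pow_ne_one_of_notMem_kernelPoles {t x z : ℂ} (hz : z ≠ 0)
    (hP : z ∉ kernelPoles p q t x) (hP' : z⁻¹ ∉ kernelPoles p q t x) (i j : ℕ) :
    t * x * z * q ^ i * p ^ j ≠ 1 ∧ t * x * z⁻¹ * q ^ i * p ^ j ≠ 1 ∧
      t * x⁻¹ * z * q ^ i * p ^ j ≠ 1 ∧ t * x⁻¹ * z⁻¹ * q ^ i * p ^ j ≠ 1 := by
  have hz' : z⁻¹ ≠ 0 := inv_ne_zero hz
  have inv_eq : ∀ c w : ℂ, w ≠ 0 → c * w * q ^ i * p ^ j = 1 → w⁻¹ = c * q ^ i * p ^ j :=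
    fun c w hw h => by
      field_simp
      rw [← h]
      ring
  refine ⟨fun h => hP' ⟨i, j, Or.inl (inv_eq _ _ hz h)⟩, fun h => hP ⟨i, j, Or.inl ?_⟩,
    fun h => hP' ⟨i, j, Or.inr (inv_eq _ _ hz h)⟩, fun h => hP ⟨i, j, Or.inr ?_⟩⟩
  · simpa using inv_eq _ _ hz' h
  · simpa using inv_eq _ _ hz' h

theorem differentiableAt_uncurry_regKernel (hp : ‖p‖ < 1) (hq : ‖q‖ < 1) {t x z : ℂ} (ht : t ≠ 0)
    (hx : x ≠ 0) (hz : z ≠ 0) (hP : z ∉ kernelPoles p q t x) (hP' : z⁻¹ ∉ kernelPoles p q t x) :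
    DifferentiableAt ℂ (uncurry (regKernel p q t)) (x, z) := by
  have hpoles := mul_pow_mul_pow_ne_one_of_notMem_kernelPoles hz hP hP'
  have hgamma : ∀ φ : ℂ × ℂ → ℂ, DifferentiableAt ℂ φ (x, z) → φ (x, z) ≠ 0 →
      (∀ i j : ℕ, φ (x, z) * q ^ i * p ^ j ≠ 1) →
      DifferentiableAt ℂ (fun w => ellGamma p q (φ w)) (x, z) := fun φ hφ hφ0 hφ1 =>
    (differentiableAt_ellGamma hp hq hφ0 hφ1).comp _ hφ
  have hreflection : DifferentiableAt ℂ (fun w : ℂ × ℂ => gammaReflection p q (w.2 ^ 2)) (x, z) :=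
    (differentiableAt_gammaReflection hp hq (pow_ne_zero 2 hz)).comp (x, z)
      (f := fun w : ℂ × ℂ => w.2 ^ 2) (by fun_prop)
  refine DifferentiableAt.mul (.mul (.mul (.mul ?_ ?_) ?_) ?_) (hreflection.mul_const _)
  · exact hgamma (fun w => t * w.1 * w.2) (by fun_prop) (by positivity) fun i j => (hpoles i j).1
  · exact hgamma (fun w => t * w.1 * w.2⁻¹) (by fun_prop (disch := assumption))
      (by positivity) fun i j => (hpoles i j).2.1
  · exact hgamma (fun w => t * w.1⁻¹ * w.2) (by fun_prop (disch := assumption))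
      (by positivity) fun i j => (hpoles i j).2.2.1
  · exact hgamma (fun w => t * w.1⁻¹ * w.2⁻¹) (by fun_prop (disch := assumption))
      (by positivity) fun i j => (hpoles i j).2.2.2

theorem differentiableAt_regKernel (hp : ‖p‖ < 1) (hq : ‖q‖ < 1) {t x z : ℂ} (ht : t ≠ 0)
    (hx : x ≠ 0) (hz : z ≠ 0) (hP : z ∉ kernelPoles p q t x) (hP' : z⁻¹ ∉ kernelPoles p q t x) :
    DifferentiableAt ℂ (regKernel p q t x) z :=
  (differentiableAt_uncurry_regKernel hp hq ht hx hz hP hP').comp z (f := fun z => (x, z))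
    (by fun_prop)

end Kernel

section DiscreteSets

/-- Bounded sets with no accumulation point other than `0`, such as the set of the inner poles of
the kernel: only finitely many of their points lie outside any disc about `0`. -/
def DiscreteOffZero (S : Set ℂ) : Prop := ∀ r > 0, {w ∈ S | r ≤ ‖w‖}.Finite

namespace DiscreteOffZero

variable {S T : Set ℂ}

theorem of_finite (hS : S.Finite) : DiscreteOffZero S := fun _ _ => hS.subset (sep_subset _ _)

theorem union (hS : DiscreteOffZero S) (hT : DiscreteOffZero T) : DiscreteOffZero (S ∪ T) :=
  fun r hr => by
    refine ((hS r hr).union (hT r hr)).subset ?_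
    rintro w ⟨hw | hw, hwr⟩
    · exact Or.inl ⟨hw, hwr⟩
    · exact Or.inr ⟨hw, hwr⟩

theorem finite_setOf_inv_mem (hS : DiscreteOffZero S) (R : ℝ) :
    {w ∈ {w : ℂ | w⁻¹ ∈ S} | ‖w‖ ≤ R}.Finite := by
  refine ((finite_singleton 0).union
    ((hS (max R 1)⁻¹ (by positivity)).preimage inv_injective.injOn)).subset ?_
  rintro w ⟨hwS, hwR⟩
  rcases eq_or_ne w 0 with hw0 | hw0
  · exact Or.inl hw0
  · refine Or.inr ⟨hwS, ?_⟩
    rw [norm_inv]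
    exact inv_anti₀ (norm_pos_iff.2 hw0) (hwR.trans (le_max_left R 1))

theorem exists_separates_inv (hS : DiscreteOffZero S) (h0 : 0 ∉ S)
    (hdisj : ∀ w ∈ S, w⁻¹ ∉ S) : ∃ C : Contour, C.Separates ({0} ∪ S) {w | w⁻¹ ∈ S} := by
  refine Contour.exists_separates ((of_finite (finite_singleton 0)).union hS)
    hS.finite_setOf_inv_mem (by simpa using h0) (disjoint_left.2 ?_)
  rintro w (rfl | hw)
  · simpa using h0
  · exact hdisj w hw

end DiscreteOffZero

variable {p q : ℂ}

theorem tendsto_mul_pow_mul_pow (hp : ‖p‖ < 1) (hq : ‖q‖ < 1) (c : ℂ) :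
    Tendsto (fun ij : ℕ × ℕ => c * q ^ ij.1 * p ^ ij.2) cofinite (𝓝 0) := by
  have h := (summable_norm_pow_mul_pow hq hp).of_norm.tendsto_cofinite_zero.const_mul c
  simpa only [mul_zero, ← mul_assoc] using h

theorem discreteOffZero_range_mul_pow_mul_pow (hp : ‖p‖ < 1) (hq : ‖q‖ < 1) (c : ℂ) :
    DiscreteOffZero (range fun ij : ℕ × ℕ => c * q ^ ij.1 * p ^ ij.2) := by
  intro r hr
  have h := (tendsto_mul_pow_mul_pow hp hq c).eventually (ball_mem_nhds 0 hr)
  refine ((eventually_cofinite.1 h).image fun ij : ℕ × ℕ => c * q ^ ij.1 * p ^ ij.2).subset ?_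
  rintro _ ⟨⟨ij, rfl⟩, hw⟩
  exact ⟨ij, by simpa using hw, rfl⟩

theorem eventually_ne_mul_pow_mul_pow (hp : ‖p‖ < 1) (hq : ‖q‖ < 1) (c : ℂ) :
    ∀ᶠ ε in 𝓝[≠] (1 : ℂ), ∀ i j : ℕ, ε ≠ c * q ^ i * p ^ j := by
  have hfin := (discreteOffZero_range_mul_pow_mul_pow hp hq c _ one_half_pos).subset
    (sdiff_subset (t := {1}))
  have h1 : ∀ᶠ ε in 𝓝 (1 : ℂ), 1 / 2 < ‖ε‖ :=
    continuous_norm.continuousAt.eventually_const_lt (by norm_num)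
  have h2 := hfin.isClosed.isOpen_compl.mem_nhds (x := (1 : ℂ)) (by simp)
  filter_upwards [nhdsWithin_le_nhds h1, nhdsWithin_le_nhds h2, self_mem_nhdsWithin]
    with ε hε1 hε2 hε3 i j h
  exact hε2 ⟨⟨⟨(i, j), h.symm⟩, hε1.le⟩, hε3⟩

theorem kernelPoles_eq (p q t x : ℂ) :
    kernelPoles p q t x = range (fun ij : ℕ × ℕ => t * x * q ^ ij.1 * p ^ ij.2) ∪
      range fun ij : ℕ × ℕ => t * x⁻¹ * q ^ ij.1 * p ^ ij.2 := by
  ext w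
  simp only [kernelPoles, mem_ofPred_eq, mem_union, mem_range, Prod.exists, ← exists_or, eq_comm]

theorem discreteOffZero_kernelPoles (hp : ‖p‖ < 1) (hq : ‖q‖ < 1) (t x : ℂ) :
    DiscreteOffZero (kernelPoles p q t x) := by
  rw [kernelPoles_eq]
  exact (discreteOffZero_range_mul_pow_mul_pow hp hq _).union
    (discreteOffZero_range_mul_pow_mul_pow hp hq _)

theorem isCompact_insert_kernelPoles (hp : ‖p‖ < 1) (hq : ‖q‖ < 1) (t x : ℂ) :
    IsCompact (insert 0 (kernelPoles p q t x)) := by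
  rw [kernelPoles_eq, insert_union_distrib]
  exact (tendsto_mul_pow_mul_pow hp hq _).isCompact_insert_range_of_cofinite.union
    (tendsto_mul_pow_mul_pow hp hq _).isCompact_insert_range_of_cofinite

theorem zero_notMem_kernelPoles (hp0 : p ≠ 0) (hq0 : q ≠ 0) {t x : ℂ} (ht : t ≠ 0) (hx : x ≠ 0) :
    (0 : ℂ) ∉ kernelPoles p q t x := by
  rintro ⟨i, j, h | h⟩
  · exact (by positivity : t * x * q ^ i * p ^ j ≠ 0) h.symm
  · exact (by positivity : t * x⁻¹ * q ^ i * p ^ j ≠ 0) h.symm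

end DiscreteSets

section Contours

variable {p q t x : ℂ} {A : Set ℂ}

theorem exists_isDefiningContour (hp0 : p ≠ 0) (hp : ‖p‖ < 1) (hq0 : q ≠ 0) (hq : ‖q‖ < 1)
    (ht : t ≠ 0) (hx : x ≠ 0) (hA : A.Finite) (hA0 : 0 ∉ A)
    (hdisj : ∀ w ∈ kernelPoles p q t x ∪ A, w⁻¹ ∉ kernelPoles p q t x ∪ A) :
    ∃ C, IsDefiningContour p q t x A C := by
  simp only [IsDefiningContour]
  rw [union_assoc]
  exact ((discreteOffZero_kernelPoles hp hq t x).union (.of_finite hA)).exists_separates_inv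
    (not_or.2 ⟨zero_notMem_kernelPoles hp0 hq0 ht hx, hA0⟩) hdisj

theorem exists_isDeformedContour (hp0 : p ≠ 0) (hp : ‖p‖ < 1) (hq0 : q ≠ 0) (hq : ‖q‖ < 1)
    (ht : t ≠ 0) (hx : x ≠ 0) (hAP : ∀ w ∈ A, w⁻¹ ∈ kernelPoles p q t x)
    (hdisj : ∀ w ∈ kernelPoles p q t x, w⁻¹ ∉ kernelPoles p q t x) :
    ∃ C, IsDeformedContour p q t x A C := by
  have hO : {w | w⁻¹ ∈ kernelPoles p q t x} ∪ A = {w | w⁻¹ ∈ kernelPoles p q t x} :=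
    union_eq_left.2 hAP
  have hI : kernelPoles p q t x ∪ {w | w⁻¹ ∈ A} = kernelPoles p q t x :=
    union_eq_left.2 fun w hw => by simpa using hAP _ hw
  simp only [IsDeformedContour]
  rw [union_assoc, hI, hO]
  exact (discreteOffZero_kernelPoles hp hq t x).exists_separates_inv
    (zero_notMem_kernelPoles hp0 hq0 ht hx) hdisj

theorem Contour.Separates.disjoint {C : Contour} {I O : Set ℂ} (hC : C.Separates I O) :
    Disjoint I O := by
  refine disjoint_left.2 fun w hI hO => zero_ne_one (α := ℂ) ?_
  rw [← (hC.1 w hI).2, (hC.2 w hO).2]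

/-- The singularities of the integrand of the elliptic Fourier transform. -/
def singularSet (p q t x : ℂ) (A : Set ℂ) : Set ℂ :=
  {0} ∪ (kernelPoles p q t x ∪ A) ∪ {z | z⁻¹ ∈ kernelPoles p q t x ∪ A}

theorem isOpen_compl_singularSet (hp : ‖p‖ < 1) (hq : ‖q‖ < 1) (t x : ℂ) (hA : A.Finite) :
    IsOpen (singularSet p q t x A)ᶜ := by
  have hP := isCompact_insert_kernelPoles hp hq t x
  have hinv := ((discreteOffZero_kernelPoles hp hq t x).union
    (.of_finite hA)).finite_setOf_inv_mem
  rw [singularSet, ← union_assoc]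
  exact ((hP.isClosed.union hA.isClosed).union
    (Contour.isClosed_of_finite_setOf_norm_le hinv)).isOpen_compl

theorem compl_singularSet_empty_diff (p q t x : ℂ) (A : Set ℂ) :
    (singularSet p q t x ∅)ᶜ \ (A ∪ {z | z⁻¹ ∈ A}) = (singularSet p q t x A)ᶜ := by
  ext z
  simp only [singularSet, union_empty, Set.mem_sdiff, mem_compl_iff, mem_union, mem_ofPred_eq,
    not_or]
  tauto

theorem IsDefiningContour.support_subset {C : Contour} (hC : IsDefiningContour p q t x A C) :
    C.support ⊆ (singularSet p q t x A)ᶜ := by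
  rw [IsDefiningContour, union_assoc] at hC
  rintro z hz (h | h)
  · exact (hC.1 z h).1 hz
  · exact (hC.2 z h).1 hz

theorem IsDeformedContour.support_subset {C : Contour} (hC : IsDeformedContour p q t x A C) :
    C.support ⊆ (singularSet p q t x A)ᶜ := by
  rintro z hz ((h | h | h) | (h | h))
  · exact (hC.1 z (Or.inl (Or.inl h))).1 hz
  · exact (hC.1 z (Or.inl (Or.inr h))).1 hz
  · exact (hC.2 z (Or.inr h)).1 hz
  · exact (hC.2 z (Or.inl h)).1 hz
  · exact (hC.1 z (Or.inr h)).1 hz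

end Contours

section Transform

variable {p q t x : ℂ} {A : Set ℂ} {α : ℂ → ℂ}

theorem eftIntegral_eq (hp : ‖p‖ < 1) (hq : ‖q‖ < 1) (t x : ℂ) (α : ℂ → ℂ) (C : Contour) :
    eftIntegral p q t x α C =
      kappa p q * C.integral fun z => regKernel p q t x z * α z / z := by
  rw [eftIntegral, C.integral_congr_of_countable (countable_kernelExceptional hp hq)]
  intro z _ hz
  rw [kernel_eq_regKernel_of_notMem hp hq t x hz]

theorem differentiableOn_integrand (hp : ‖p‖ < 1) (hq : ‖q‖ < 1) (ht : t ≠ 0) (hx : x ≠ 0)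
    (hα : ∀ z, z ≠ 0 → z ∉ A → z⁻¹ ∉ A → DifferentiableAt ℂ α z) :
    DifferentiableOn ℂ (fun z => regKernel p q t x z * α z / z) (singularSet p q t x A)ᶜ := by
  intro z hz
  simp only [singularSet, mem_compl_iff, mem_ofPred_eq, mem_union, mem_singleton_iff, not_or] at hz
  obtain ⟨⟨h0, hP, hA⟩, hP', hA'⟩ := hz
  exact (((differentiableAt_regKernel hp hq ht hx h0 hP hP').mul (hα z h0 hA hA')).fun_div
    differentiableAt_id h0).differentiableWithinAt

theorem eftIntegral_eq_of_isDefiningContour (hp : ‖p‖ < 1) (hq : ‖q‖ < 1) (ht : t ≠ 0)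
    (hx : x ≠ 0) (hA : A.Finite)
    (hα : ∀ z, z ≠ 0 → z ∉ A → z⁻¹ ∉ A → DifferentiableAt ℂ α z) {C C' : Contour}
    (hC : IsDefiningContour p q t x A C) (hC' : IsDefiningContour p q t x A C') :
    eftIntegral p q t x α C = eftIntegral p q t x α C' := by
  rw [eftIntegral_eq hp hq, eftIntegral_eq hp hq, C.integral_eq_of_winding_eq C'
    (isOpen_compl_singularSet hp hq t x hA) (differentiableOn_integrand hp hq ht hx hα)
    hC.support_subset hC'.support_subset]
  rw [IsDefiningContour, union_assoc] at hC hC'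
  intro z hz
  rcases notMem_compl_iff.1 hz with h | h
  · rw [(hC.1 z h).2, (hC'.1 z h).2]
  · rw [(hC.2 z h).2, (hC'.2 z h).2]

theorem existsUnique_isEFT (hp0 : p ≠ 0) (hp : ‖p‖ < 1) (hq0 : q ≠ 0) (hq : ‖q‖ < 1) (ht : t ≠ 0)
    (hx : x ≠ 0) (hA : A.Finite) (hA0 : 0 ∉ A)
    (hdisj : ∀ w ∈ kernelPoles p q t x ∪ A, w⁻¹ ∉ kernelPoles p q t x ∪ A)
    (hα : ∀ z, z ≠ 0 → z ∉ A → z⁻¹ ∉ A → DifferentiableAt ℂ α z) :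
    ∃! b, IsEFT p q t x A α b := by
  obtain ⟨C, hC⟩ := exists_isDefiningContour hp0 hp hq0 hq ht hx hA hA0 hdisj
  refine ⟨_, ⟨C, hC, rfl⟩, ?_⟩
  rintro _ ⟨C', hC', rfl⟩
  exact eftIntegral_eq_of_isDefiningContour hp hq ht hx hA hα hC' hC

theorem tendsto_integrand_residue (hp : ‖p‖ < 1) (hq : ‖q‖ < 1) (ht : t ≠ 0) (hx : x ≠ 0)
    {s r : ℂ} (hs : s ≠ 0) (hP : s ∉ kernelPoles p q t x) (hP' : s⁻¹ ∉ kernelPoles p q t x)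
    (hr : Tendsto (fun z => (1 - s / z) * α z) (𝓝[≠] s) (𝓝 r)) :
    Tendsto (fun z => (z - s) * (regKernel p q t x z * α z / z)) (𝓝[≠] s)
      (𝓝 (regKernel p q t x s * r)) := by
  have hK := ((differentiableAt_regKernel hp hq ht hx hs hP hP').continuousAt.tendsto.mono_left
    (nhdsWithin_le_nhds (s := {s}ᶜ))).mul hr
  refine hK.congr' ?_
  filter_upwards [nhdsWithin_le_nhds (isOpen_ne.mem_nhds hs)] with z (hz : z ≠ 0)
  field_simp

theorem tendsto_inv_nhdsNE {s : ℂ} (hs : s ≠ 0) :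
    Tendsto (fun z : ℂ => z⁻¹) (𝓝[≠] s⁻¹) (𝓝[≠] s) := by
  have h := (tendsto_inv₀ (inv_ne_zero hs)).mono_left (nhdsWithin_le_nhds (s := {s⁻¹}ᶜ))
  rw [inv_inv] at h
  refine tendsto_nhdsWithin_iff.2 ⟨h, ?_⟩
  filter_upwards [self_mem_nhdsWithin] with z hz hzs
  exact hz (inv_eq_iff_eq_inv.1 hzs)

theorem tendsto_integrand_residue_inv (hp : ‖p‖ < 1) (hq : ‖q‖ < 1) (ht : t ≠ 0) (hx : x ≠ 0)
    {s r : ℂ} (hs : s ≠ 0) (hP : s ∉ kernelPoles p q t x) (hP' : s⁻¹ ∉ kernelPoles p q t x)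
    (hr : Tendsto (fun z => (1 - s / z) * α z) (𝓝[≠] s) (𝓝 r))
    (hsymm : ∀ᶠ z in 𝓝[≠] s⁻¹, α z⁻¹ = α z) :
    Tendsto (fun z => (z - s⁻¹) * (regKernel p q t x z * α z / z)) (𝓝[≠] s⁻¹)
      (𝓝 (-(regKernel p q t x s * r))) := by
  have hs' : s⁻¹ ≠ 0 := inv_ne_zero hs
  have hK : Tendsto (regKernel p q t x) (𝓝[≠] s⁻¹) (𝓝 (regKernel p q t x s)) := by
    rw [← regKernel_inv p q t x s]
    exact (differentiableAt_regKernel hp hq ht hx hs' hP'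
      (by rwa [inv_inv])).continuousAt.tendsto.mono_left nhdsWithin_le_nhds
  have hc : Tendsto (fun z : ℂ => -(z⁻¹ / s)) (𝓝[≠] s⁻¹) (𝓝 (-(s / s))) :=
    (((tendsto_inv_nhdsNE hs).mono_right nhdsWithin_le_nhds).div_const s).neg
  have h := hK.mul (hc.mul (hr.comp (tendsto_inv_nhdsNE hs)))
  rw [div_self hs, neg_one_mul, mul_neg] at h
  refine h.congr' ?_
  filter_upwards [nhdsWithin_le_nhds (isOpen_ne.mem_nhds hs'), hsymm] with z (hz : z ≠ 0) hαz
  simp only [comp_apply, hαz]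
  field_simp
  ring

open Classical in
theorem Contour.integral_sub_integral_eq_sum_residues_of_inv (C C' : Contour) {U : Set ℂ}
    (hU : IsOpen U) {A : Finset ℂ} (hAU : ∀ s ∈ A, s ∈ U ∧ s⁻¹ ∈ U) (hinv : ∀ s ∈ A, s⁻¹ ∉ A)
    {f ρ : ℂ → ℂ} (hf : DifferentiableOn ℂ f (U \ ((A : Set ℂ) ∪ {z | z⁻¹ ∈ (A : Set ℂ)})))
    (hlim : ∀ s ∈ A, Tendsto (fun z => (z - s) * f z) (𝓝[≠] s) (𝓝 (ρ s)) ∧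
      Tendsto (fun z => (z - s⁻¹) * f z) (𝓝[≠] s⁻¹) (𝓝 (-ρ s)))
    (hC : C.support ⊆ U \ ((A : Set ℂ) ∪ {z | z⁻¹ ∈ (A : Set ℂ)}))
    (hC' : C'.support ⊆ U \ ((A : Set ℂ) ∪ {z | z⁻¹ ∈ (A : Set ℂ)}))
    (hwind : ∀ z ∉ U, C.winding z = C'.winding z)
    (hCA : ∀ s ∈ A, C.winding s = 1 ∧ C.winding s⁻¹ = 0)
    (hCA' : ∀ s ∈ A, C'.winding s = 0 ∧ C'.winding s⁻¹ = 1) :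
    C.integral f - C'.integral f = 4 * Real.pi * Complex.I * ∑ s ∈ A, ρ s := by
  have hF : (A : Set ℂ) ∪ {z | z⁻¹ ∈ (A : Set ℂ)} = (A ∪ A.image (·⁻¹) : Finset ℂ) := by
    ext z
    simp
  rw [hF] at hf hC hC'
  have hdisj : Disjoint A (A.image (·⁻¹)) := by
    refine Finset.disjoint_left.2 fun s hs hs' => ?_
    obtain ⟨w, hw, rfl⟩ := Finset.mem_image.1 hs'
    exact hinv w hw hs
  rw [C.integral_sub_integral_eq_sum_residues C' hU (r := fun s => if s ∈ A then ρ s else -ρ s⁻¹)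
    ?_ hf ?_ hC hC' hwind, Finset.sum_union hdisj, Finset.sum_image inv_injective.injOn,
    ← Finset.sum_add_distrib, Finset.mul_sum, Finset.mul_sum]
  · refine Finset.sum_congr rfl fun s hs => ?_
    rw [if_pos hs, if_neg (hinv s hs), (hCA s hs).1, (hCA s hs).2, (hCA' s hs).1, (hCA' s hs).2,
      inv_inv]
    ring
  · intro s hs
    rcases hF ▸ hs with hs | hs
    · exact (hAU s hs).1
    · exact inv_inv s ▸ (hAU _ hs).2
  · simp only [Finset.forall_mem_union, Finset.forall_mem_image]
    refine ⟨fun s hs => ?_, fun s hs => ?_⟩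
    · simpa only [if_pos hs] using (hlim s hs).1
    · simpa only [if_neg (hinv s hs), inv_inv] using (hlim s hs).2

theorem eventually_comp_inv_eq (hA : A.Finite)
    (hsymm : ∀ z, z ≠ 0 → z ∉ A → z⁻¹ ∉ A → α z⁻¹ = α z) (s : ℂ) :
    ∀ᶠ z in 𝓝[≠] s, α z⁻¹ = α z := by
  have hfin : ({0} ∪ A ∪ {z | z⁻¹ ∈ A}).Finite :=
    ((finite_singleton 0).union hA).union (hA.preimage inv_injective.injOn)
  filter_upwards [nhdsNE_of_nhdsNE_sdiff_finite univ_mem hfin] with z hz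
  obtain ⟨⟨h0, hzA⟩, hzA'⟩ := (not_or.1 hz.2).imp_left not_or.1
  exact hsymm z h0 hzA hzA'

theorem integral_integrand_sub_eq_sum_residues (hp : ‖p‖ < 1) (hq : ‖q‖ < 1) (ht : t ≠ 0)
    (hx : x ≠ 0) {A : Finset ℂ}
    (hα : ∀ z, z ≠ 0 → z ∉ A → z⁻¹ ∉ A → DifferentiableAt ℂ α z)
    (hsymm : ∀ z, z ≠ 0 → z ∉ A → z⁻¹ ∉ A → α z⁻¹ = α z) {r : ℂ → ℂ}
    (hr : ∀ s ∈ A, Tendsto (fun z => (1 - s / z) * α z) (𝓝[≠] s) (𝓝 (r s))) {C C' : Contour}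
    (hC : IsDefiningContour p q t x A C) (hC' : IsDeformedContour p q t x A C') :
    C.integral (fun z => regKernel p q t x z * α z / z) -
        C'.integral (fun z => regKernel p q t x z * α z / z) =
      4 * Real.pi * Complex.I * ∑ s ∈ A, regKernel p q t x s * r s := by
  have hinv : ∀ s ∈ A, s⁻¹ ∉ A := fun s hs h =>
    disjoint_left.1 hC.disjoint (Or.inr hs) (Or.inr h)
  have hA0 : ∀ s ∈ A, s ≠ 0 := by
    rintro _ hs rfl
    exact hinv 0 hs (by rwa [inv_zero])
  have hP : ∀ s ∈ A, s ∉ kernelPoles p q t x := fun s hs h =>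
    disjoint_left.1 hC'.disjoint (Or.inl (Or.inr h)) (Or.inr hs)
  have hP' : ∀ s ∈ A, s⁻¹ ∉ kernelPoles p q t x := fun s hs h =>
    disjoint_left.1 hC.disjoint (Or.inr hs) (Or.inl h)
  have hdiff := compl_singularSet_empty_diff p q t x A
  refine C.integral_sub_integral_eq_sum_residues_of_inv C'
    (isOpen_compl_singularSet hp hq t x finite_empty)
    (fun s hs => ?_) hinv (hdiff ▸ differentiableOn_integrand hp hq ht hx hα)
    (fun s hs => ⟨tendsto_integrand_residue hp hq ht hx (hA0 s hs) (hP s hs) (hP' s hs) (hr s hs),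
      tendsto_integrand_residue_inv hp hq ht hx (hA0 s hs) (hP s hs) (hP' s hs) (hr s hs)
        (eventually_comp_inv_eq A.finite_toSet hsymm s⁻¹)⟩)
    (hdiff ▸ hC.support_subset) (hdiff ▸ hC'.support_subset) (fun z hz => ?_)
    (fun s hs => ⟨(hC.1 s (Or.inr hs)).2, (hC.2 s⁻¹ (Or.inr (by simpa using hs))).2⟩)
    (fun s hs => ⟨(hC'.2 s (Or.inr hs)).2, (hC'.1 s⁻¹ (Or.inr (by simpa using hs))).2⟩)
  · simp [singularSet, hA0 s hs, hP s hs, hP' s hs]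
  · rcases notMem_compl_iff.1 hz with (h | h | h) | (h | h)
    · rw [(hC.1 z (Or.inl (Or.inl h))).2, (hC'.1 z (Or.inl (Or.inl h))).2]
    · rw [(hC.1 z (Or.inl (Or.inr h))).2, (hC'.1 z (Or.inl (Or.inr h))).2]
    · exact absurd h (notMem_empty z)
    · rw [(hC.2 z (Or.inl h)).2, (hC'.2 z (Or.inl h)).2]
    · exact absurd h (notMem_empty z⁻¹)

theorem eftIntegral_eq_add_residues (hp : ‖p‖ < 1) (hq : ‖q‖ < 1) (ht : t ≠ 0) (hx : x ≠ 0)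
    {A : Finset ℂ} (hα : ∀ z, z ≠ 0 → z ∉ A → z⁻¹ ∉ A → DifferentiableAt ℂ α z)
    (hsymm : ∀ z, z ≠ 0 → z ∉ A → z⁻¹ ∉ A → α z⁻¹ = α z) {r : ℂ → ℂ}
    (hr : ∀ s ∈ A, Tendsto (fun z => (1 - s / z) * α z) (𝓝[≠] s) (𝓝 (r s)))
    (hAe : ∀ s ∈ A, s ∉ kernelExceptional p q) {C C' : Contour}
    (hC : IsDefiningContour p q t x A C) (hC' : IsDeformedContour p q t x A C') :
    eftIntegral p q t x α C = eftIntegral p q t x α C' +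
      4 * Real.pi * Complex.I * kappa p q * ∑ s ∈ A, kernel p q t x s * r s := by
  have hkernel : ∑ s ∈ A, kernel p q t x s * r s = ∑ s ∈ A, regKernel p q t x s * r s :=
    Finset.sum_congr rfl fun s hs => by rw [kernel_eq_regKernel_of_notMem hp hq t x (hAe s hs)]
  rw [eftIntegral_eq hp hq, eftIntegral_eq hp hq, hkernel]
  linear_combination
    kappa p q * integral_integrand_sub_eq_sum_residues hp hq ht hx hα hsymm hr hC hC'

end Transform

section Deformation

variable {p q t x : ℂ} {A : Set ℂ} {α : ℂ → ℂ}

theorem mem_kernelPoles_inv_mul {ε w : ℂ} (hw : w ∈ kernelPoles p q t (ε⁻¹ * x)) :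
    ∃ u ∈ kernelPoles p q t x, w = ε⁻¹ * u ∨ w = ε * u := by
  obtain ⟨i, j, rfl | rfl⟩ := hw
  · exact ⟨_, ⟨i, j, Or.inl rfl⟩, Or.inl (by ring)⟩
  · refine ⟨_, ⟨i, j, Or.inr rfl⟩, Or.inr ?_⟩
    rw [mul_inv, inv_inv]
    ring

theorem eventually_kernelPoles_subset (hp : ‖p‖ < 1) (hq : ‖q‖ < 1) {Ω : Set ℂ} (hΩ : IsOpen Ω)
    (hPΩ : insert 0 (kernelPoles p q t x) ⊆ Ω) :
    ∀ᶠ ε in 𝓝 (1 : ℂ), kernelPoles p q t (ε⁻¹ * x) ⊆ Ω := by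
  have hev : ∀ᶠ ε in 𝓝 (1 : ℂ), ∀ u ∈ insert 0 (kernelPoles p q t x),
      ε⁻¹ * u ∈ Ω ∧ ε * u ∈ Ω := by
    refine (isCompact_insert_kernelPoles hp hq t x).eventually_forall_of_forall_eventually
      fun u hu => ?_
    have hinv : ContinuousAt (fun z : ℂ × ℂ => z.1⁻¹ * z.2) (1, u) :=
      (continuousAt_fst.inv₀ one_ne_zero).mul continuousAt_snd
    have hmul : ContinuousAt (fun z : ℂ × ℂ => z.1 * z.2) (1, u) := by fun_prop
    exact (hinv.eventually_mem (hΩ.mem_nhds (by simpa using hPΩ hu))).and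
      (hmul.eventually_mem (hΩ.mem_nhds (by simpa using hPΩ hu)))
  filter_upwards [hev] with ε hε w hw
  obtain ⟨u, hu, rfl | rfl⟩ := mem_kernelPoles_inv_mul hw
  · exact (hε u (Or.inr hu)).1
  · exact (hε u (Or.inr hu)).2

theorem Contour.isOpen_setOf_inv_winding_eq_zero (C : Contour) :
    IsOpen {u : ℂ | u = 0 ∨ u⁻¹ ∉ C.support ∧ C.winding u⁻¹ = 0} := by
  refine isOpen_iff_mem_nhds.2 fun u hu => ?_
  rcases eq_or_ne u 0 with rfl | hu0
  · obtain ⟨R, hR, hCR⟩ := C.isCompact_support.isBounded.subset_ball_lt 0 0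
    filter_upwards [ball_mem_nhds (0 : ℂ) (inv_pos.2 hR)] with v hv
    refine or_iff_not_imp_left.2 fun hv0 => ?_
    have hvR : v⁻¹ ∉ ball 0 R := by
      rw [mem_ball_zero_iff] at hv
      rw [mem_ball_zero_iff, norm_inv, not_lt]
      exact ((lt_inv_comm₀ hR (norm_pos_iff.2 hv0)).2 hv).le
    exact ⟨fun h => hvR (hCR h), C.winding_eq_zero_of_notMem_ball hCR hvR⟩
  · have hV := (C.isOpen_setOf_winding_eq 0).mem_nhds (hu.resolve_left hu0)
    filter_upwards [(continuousAt_inv₀ hu0).preimage_mem_nhds hV] with v hv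
    exact Or.inr hv

theorem IsDeformedContour.eventually (hp : ‖p‖ < 1) (hq : ‖q‖ < 1) {C : Contour}
    (hC : IsDeformedContour p q t x A C) :
    ∀ᶠ ε in 𝓝 (1 : ℂ), IsDeformedContour p q t (ε⁻¹ * x) A C := by
  have h0 : 0 ∉ kernelPoles p q t x := fun h =>
    disjoint_left.1 hC.disjoint (Or.inl (Or.inl (mem_singleton 0))) (Or.inl (by simpa using h))
  have hPΩ : insert 0 (kernelPoles p q t x) ⊆ {u | u ∉ C.support ∧ C.winding u = 1} ∩
      {u | u = 0 ∨ u⁻¹ ∉ C.support ∧ C.winding u⁻¹ = 0} := by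
    rintro u (rfl | hu)
    · exact ⟨hC.1 0 (by simp), Or.inl rfl⟩
    · exact ⟨hC.1 u (Or.inl (Or.inr hu)), Or.inr (hC.2 u⁻¹ (Or.inl (by simpa using hu)))⟩
  filter_upwards [eventually_kernelPoles_subset hp hq
    ((C.isOpen_setOf_winding_eq 1).inter C.isOpen_setOf_inv_winding_eq_zero) hPΩ,
    isOpen_ne.mem_nhds (one_ne_zero : (1 : ℂ) ≠ 0)] with ε hε hε0
  refine ⟨?_, ?_⟩
  · rintro w ((hw | hw) | hw)
    · exact hC.1 w (Or.inl (Or.inl hw))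
    · exact (hε hw).1
    · exact hC.1 w (Or.inr hw)
  · rintro w (hw | hw)
    · have hw0 : w⁻¹ ≠ 0 := by
        obtain ⟨u, hu, hwu | hwu⟩ := mem_kernelPoles_inv_mul hw
        · exact hwu ▸ mul_ne_zero (inv_ne_zero hε0) (ne_of_mem_of_not_mem hu h0)
        · exact hwu ▸ mul_ne_zero hε0 (ne_of_mem_of_not_mem hu h0)
      simpa using (hε hw).2.resolve_left hw0
    · exact hC.2 w (Or.inr hw)

theorem continuousAt_eftIntegral_inv_mul (hp : ‖p‖ < 1) (hq : ‖q‖ < 1) (ht : t ≠ 0) (hx : x ≠ 0)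
    (hα : ∀ z, z ≠ 0 → z ∉ A → z⁻¹ ∉ A → DifferentiableAt ℂ α z) {C : Contour}
    (hC : IsDeformedContour p q t x A C) :
    ContinuousAt (fun ε => eftIntegral p q t (ε⁻¹ * x) α C) 1 := by
  have hU := (hC.eventually hp hq).and (isOpen_ne.mem_nhds (one_ne_zero : (1 : ℂ) ≠ 0))
  have hdiff : ∀ ε z, IsDeformedContour p q t (ε⁻¹ * x) A C ∧ ε ≠ 0 → z ∈ C.support →
      DifferentiableAt ℂ
        (uncurry fun ε z => regKernel p q t (ε⁻¹ * x) z * α z / z) (ε, z) := by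
    rintro ε z ⟨hε, hε0⟩ hz
    have hsing := hε.support_subset hz
    simp only [singularSet, mem_compl_iff, mem_ofPred_eq, mem_union, mem_singleton_iff,
      not_or] at hsing
    obtain ⟨⟨hz0, hP, hA⟩, hP', hA'⟩ := hsing
    have hK := (differentiableAt_uncurry_regKernel hp hq ht (mul_ne_zero (inv_ne_zero hε0) hx) hz0
      hP hP').comp (ε, z) (f := fun w : ℂ × ℂ => (w.1⁻¹ * x, w.2))
      (by fun_prop (disch := assumption))
    have hαz := (hα z hz0 hA hA').comp (ε, z) (f := fun w : ℂ × ℂ => w.2) (by fun_prop)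
    have hinv : DifferentiableAt ℂ (fun w : ℂ × ℂ => w.2⁻¹) (ε, z) :=
      DifferentiableAt.inv differentiableAt_snd hz0
    simpa only [uncurry_def, div_eq_mul_inv] using! (hK.mul hαz).mul hinv
  have hcont := (C.hasDerivAt_integral hU
    (F := fun ε z => regKernel p q t (ε⁻¹ * x) z * α z / z)
    (fun w hw => (hdiff w.1 w.2 hw.1 hw.2).continuousAt.continuousWithinAt)
    (fun z hz ε hε => ((hdiff ε z hε hz).comp ε (f := fun ε => (ε, z))
      (by fun_prop)).differentiableWithinAt)).continuousAt
  simp only [eftIntegral_eq hp hq]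
  exact hcont.const_mul _

theorem tendsto_one_sub_mul_eftIntegral (hp : ‖p‖ < 1) (hq : ‖q‖ < 1)
    (ht : t ≠ 0) (hx : x ≠ 0) (hα : ∀ z, z ≠ 0 → z ∉ A → z⁻¹ ∉ A → DifferentiableAt ℂ α z)
    {C : Contour} (hC : IsDeformedContour p q t x A C) :
    Tendsto (fun ε => (1 - ε) * eftIntegral p q t (ε⁻¹ * x) α C) (𝓝[≠] (1 : ℂ)) (𝓝 0) := by
  have hcont : ContinuousAt (fun ε => (1 - ε) * eftIntegral p q t (ε⁻¹ * x) α C) 1 :=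
    (continuousAt_const.sub continuousAt_id).mul
      (continuousAt_eftIntegral_inv_mul hp hq ht hx hα hC)
  simpa using hcont.tendsto.mono_left nhdsWithin_le_nhds

end Deformation

section EllipticPochhammer

variable {p q : ℂ}

theorem ellPoch_natCast_ne_zero {z : ℂ} {n : ℕ} (h : ∀ j < n, theta (z * q ^ j) p ≠ 0) :
    ellPoch p q z n ≠ 0 :=
  Finset.prod_ne_zero_iff.2 fun j hj => h j (Finset.mem_range.1 hj)

theorem ellPoch_natCast_add (p q z : ℂ) (m n : ℕ) :
    ellPoch p q z ((m + n : ℕ) : ℤ) = ellPoch p q z m * ellPoch p q (z * q ^ m) n := by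
  simp only [ellPoch_natCast, Finset.prod_range_add, pow_add, mul_assoc]

theorem ellPoch_one (p q z : ℂ) : ellPoch p q z (1 : ℕ) = theta z p := by
  rw [ellPoch_natCast, Finset.prod_range_one, pow_zero, mul_one]

theorem ellPoch_inv_mul_pow (hp : ‖p‖ < 1) (hq0 : q ≠ 0) {b : ℂ} (hb : b ≠ 0) (n : ℕ) :
    ellPoch p q (b * q ^ n)⁻¹ n =
      (∏ j ∈ Finset.range n, -(b * q ^ (j + 1))⁻¹) * ellPoch p q (b * q) n := by
  rw [ellPoch_natCast, ellPoch_natCast, ← Finset.prod_range_reflect, ← Finset.prod_mul_distrib]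
  refine Finset.prod_congr rfl fun j hj => ?_
  have hpow : q ^ n = q ^ (n - 1 - j) * q ^ (j + 1) := by
    rw [← pow_add, show n - 1 - j + (j + 1) = n by have := Finset.mem_range.1 hj; omega]
  have harg : (b * q ^ n)⁻¹ * q ^ (n - 1 - j) = (b * q ^ (j + 1))⁻¹ := by
    rw [hpow]
    field_simp
  rw [harg, theta_inv hp (mul_ne_zero hb (pow_ne_zero _ hq0)), pow_succ', mul_assoc b]

theorem ellPoch_inv_mul_pow_ne_zero (hp : ‖p‖ < 1) (hq0 : q ≠ 0) {b : ℂ} (hb : b ≠ 0) {n : ℕ}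
    (h : ellPoch p q (b * q) n ≠ 0) : ellPoch p q (b * q ^ n)⁻¹ n ≠ 0 := by
  rw [ellPoch_inv_mul_pow hp hq0 hb]
  exact mul_ne_zero (Finset.prod_ne_zero_iff.2 fun j _ =>
    neg_ne_zero.2 (inv_ne_zero (mul_ne_zero hb (pow_ne_zero _ hq0)))) h

theorem ellPoch_inv_pow_ne_zero (hp : ‖p‖ < 1) (hq0 : q ≠ 0) {n : ℕ} (h : ellPoch p q q n ≠ 0) :
    ellPoch p q (q ^ n)⁻¹ n ≠ 0 := by
  have := ellPoch_inv_mul_pow_ne_zero hp hq0 one_ne_zero (n := n) (by rwa [one_mul])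
  rwa [one_mul] at this

theorem prod_inv_mul_pow_mul_eq (hq0 : q ≠ 0) {a : ℂ} (ha0 : a ≠ 0) (m n : ℕ) :
    (∏ j ∈ Finset.range n, -(1 * q ^ (j + 1))⁻¹) *
        (∏ j ∈ Finset.range n, -(a * q ^ (2 * m) * q ^ (j + 1))⁻¹) *
        (a ^ n * q ^ ((m + n) * (m + n + 1))) = q ^ (m * (m + 1)) := by
  induction n with
  | zero => simp
  | succ n ih =>
    rw [← ih, Finset.prod_range_succ, Finset.prod_range_succ]
    field_simp
    ring

theorem ellPoch_inv_pow_mul_ellPoch_inv (hp : ‖p‖ < 1) (hq0 : q ≠ 0) {a : ℂ} (ha0 : a ≠ 0)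
    (m n : ℕ) :
    ellPoch p q (q ^ n)⁻¹ n * ellPoch p q (a * q ^ (2 * m + n))⁻¹ n *
        (a ^ n * q ^ ((m + n) * (m + n + 1))) =
      q ^ (m * (m + 1)) * ellPoch p q q n * ellPoch p q (a * q ^ (2 * m + 1)) n := by
  have h₁ := ellPoch_inv_mul_pow hp hq0 one_ne_zero n
  have h₂ := ellPoch_inv_mul_pow hp hq0 (mul_ne_zero ha0 (pow_ne_zero (2 * m) hq0)) n
  rw [one_mul, one_mul] at h₁
  rw [mul_assoc a, ← pow_add, mul_assoc a, ← pow_succ] at h₂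
  rw [h₁, h₂, ← prod_inv_mul_pow_mul_eq hq0 ha0 m n]
  ring

theorem theta_mul_ellPoch (p q a : ℂ) (m n : ℕ) :
    theta a p * ellPoch p q (q * a) ((2 * m + n : ℕ) : ℤ) =
      ellPoch p q a ((2 * m : ℕ) : ℤ) * theta (a * q ^ (2 * m)) p *
        ellPoch p q (a * q ^ (2 * m + 1)) n := by
  calc theta a p * ellPoch p q (q * a) ((2 * m + n : ℕ) : ℤ)
      = ellPoch p q a ((1 + (2 * m + n) : ℕ) : ℤ) := by
        rw [ellPoch_natCast_add p q a 1, ellPoch_one, pow_one, mul_comm a]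
    _ = ellPoch p q a ((2 * m + (1 + n) : ℕ) : ℤ) := by
        rw [Nat.add_left_comm]
    _ = _ := by
        rw [ellPoch_natCast_add, ellPoch_natCast_add, ellPoch_one, pow_one, mul_assoc a,
          ← pow_succ, mul_assoc]

theorem baileyMatrix_add (p q a k : ℂ) (m n : ℕ) :
    baileyMatrix p q a k (m + n) m =
      (ellPoch p q k ((2 * m + n : ℕ) : ℤ) * ellPoch p q (k / a) n) /
          (ellPoch p q (q * a) ((2 * m + n : ℕ) : ℤ) * ellPoch p q q n) *
        (theta (a * q ^ (2 * m)) p / theta a p) * a ^ n := by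
  have hadd : ((m + n : ℕ) : ℤ) + m = ((2 * m + n : ℕ) : ℤ) := by push_cast; ring
  have hsub : ((m + n : ℕ) : ℤ) - m = (n : ℤ) := by push_cast; ring
  rw [baileyMatrix, hadd, hsub, zpow_natCast]

-- Since `θ(1; p) = 0`, the convention `0⁻¹ = 0` makes `θ(q)_{n-m}` itself vanish for `n < m`,
-- and dividing by it gives `0` again, the value prescribed for `1 / θ(q)_{n-m}`.
theorem baileyMatrix_eq_zero (hp : ‖p‖ < 1) (hq0 : q ≠ 0) (a k : ℂ) {n m : ℕ} (h : n < m) :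
    baileyMatrix p q a k n m = 0 := by
  obtain ⟨l, rfl⟩ := Nat.exists_eq_add_of_lt h
  have hsub : (n : ℤ) - ((n + l + 1 : ℕ) : ℤ) = Int.negSucc l := by
    rw [Int.negSucc_eq]
    push_cast
    ring
  have hzero : ellPoch p q q (Int.negSucc l) = 0 := by
    refine Finset.prod_eq_zero (i := 1) (by simp) ?_
    rw [pow_one, mul_inv_cancel₀ hq0, theta_one hp, inv_zero]
  rw [baileyMatrix, hsub, hzero, mul_zero, div_zero, zero_mul, zero_mul]

/-- The theta factors that the residues produce are those of the matrix `M_{m+n,m}`, up to the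
powers of `q` absorbed into the renormalized sequences. -/
theorem inv_ellPoch_mul_eq (hp : ‖p‖ < 1) (hq0 : q ≠ 0) {a : ℂ} (ha0 : a ≠ 0) {m n : ℕ}
    (hθ : ∀ l ≤ 2 * m + n, theta (a * q ^ l) p ≠ 0) (hqn : ellPoch p q q n ≠ 0) :
    (ellPoch p q (q ^ n)⁻¹ n * ellPoch p q a ((2 * m : ℕ) : ℤ) *
        ellPoch p q (a * q ^ (2 * m + n))⁻¹ n)⁻¹ =
      q ^ ((m + n) * (m + n + 1)) * a ^ n * theta (a * q ^ (2 * m)) p /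
        (theta a p * ellPoch p q (q * a) ((2 * m + n : ℕ) : ℤ) * ellPoch p q q n *
          q ^ (m * (m + 1))) := by
  have hlow : ellPoch p q a ((2 * m : ℕ) : ℤ) ≠ 0 :=
    ellPoch_natCast_ne_zero fun j hj => hθ j (by omega)
  have hmid := hθ (2 * m) (by omega)
  have hhigh : ellPoch p q (a * q ^ (2 * m + 1)) n ≠ 0 :=
    ellPoch_natCast_ne_zero fun j hj => by
      rw [mul_assoc, ← pow_add]
      exact hθ _ (by omega)
  have hsplit := theta_mul_ellPoch p q a m n
  have hinv := ellPoch_inv_pow_mul_ellPoch_inv hp hq0 ha0 m n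
  have hqm := pow_ne_zero (m * (m + 1)) hq0
  have hfactors : ellPoch p q (q ^ n)⁻¹ n * ellPoch p q (a * q ^ (2 * m + n))⁻¹ n ≠ 0 :=
    left_ne_zero_of_mul (hinv ▸ mul_ne_zero (mul_ne_zero hqm hqn) hhigh)
  rw [hsplit, inv_eq_one_div, div_eq_div_iff]
  · linear_combination
      -(ellPoch p q a ((2 * m : ℕ) : ℤ) * theta (a * q ^ (2 * m)) p) * hinv
  · rw [mul_right_comm]
    exact mul_ne_zero hfactors hlow
  · exact mul_ne_zero (mul_ne_zero (mul_ne_zero (mul_ne_zero hlow hmid) hhigh) hqn) hqm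

end EllipticPochhammer

section KernelLimit

variable {p q : ℂ}

theorem eventually_inv_ne_mul_pow_mul_pow (hp : ‖p‖ < 1) (hq : ‖q‖ < 1) (c : ℂ) :
    ∀ᶠ ε in 𝓝[≠] (1 : ℂ), ∀ i j : ℕ, ε⁻¹ ≠ c * q ^ i * p ^ j := by
  have hinv := tendsto_inv_nhdsNE (one_ne_zero : (1 : ℂ) ≠ 0)
  rw [inv_one] at hinv
  exact hinv.eventually (eventually_ne_mul_pow_mul_pow hp hq c)

theorem tendsto_one_sub_mul_ellGamma_mul_inv_pow (hp : ‖p‖ < 1) (hq : ‖q‖ < 1) (hq0 : q ≠ 0)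
    {n : ℕ} (hn : ellPoch p q (q ^ n)⁻¹ n ≠ 0) :
    Tendsto (fun ε => (1 - ε) * ellGamma p q (ε * (q ^ n)⁻¹)) (𝓝[≠] 1)
      (𝓝 ((qPochInf p p * qPochInf q q)⁻¹ / ellPoch p q (q ^ n)⁻¹ n)) := by
  have hqn : q ^ n ≠ 0 := pow_ne_zero n hq0
  have hprod : Tendsto (fun ε => ellPoch p q (ε * (q ^ n)⁻¹) n) (𝓝[≠] 1)
      (𝓝 (ellPoch p q (q ^ n)⁻¹ n)) := by
    simp only [ellPoch_natCast]
    refine tendsto_finsetProd _ fun j _ => ?_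
    have hc : ContinuousAt (fun ε : ℂ => theta (ε * (q ^ n)⁻¹ * q ^ j) p) 1 :=
      (continuousAt_theta hp (mul_ne_zero (inv_ne_zero hqn) (pow_ne_zero j hq0))).comp_of_eq
        (f := fun ε : ℂ => ε * (q ^ n)⁻¹ * q ^ j) (by fun_prop) (by ring)
    simpa only [one_mul] using hc.tendsto.mono_left (nhdsWithin_le_nhds (s := {1}ᶜ))
  refine ((tendsto_one_sub_mul_ellGamma hp hq).div hprod hn).congr' ?_
  filter_upwards [eventually_inv_ne_mul_pow_mul_pow hp hq (q ^ n)⁻¹, hprod.eventually_ne hn]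
    with ε hε hε'
  have h := ellGamma_mul_pow hp hq hq0 (z := ε * (q ^ n)⁻¹) (fun i j hij => hε i j ?_) n
  · rw [inv_mul_cancel_right₀ hqn] at h
    rw [Pi.div_apply, h, div_eq_iff hε']
    ring
  · refine inv_eq_of_mul_eq_one_right ?_
    rw [← hij]
    ring

theorem tendsto_ellGamma_mul (hp : ‖p‖ < 1) (hq : ‖q‖ < 1) {c : ℂ} (hc : c ≠ 0)
    (h : ∀ i j : ℕ, c * q ^ i * p ^ j ≠ 1) {l : Filter ℂ} {f : ℂ → ℂ} (hf : Tendsto f l (𝓝 1)) :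
    Tendsto (fun ε => ellGamma p q (f ε * c)) l (𝓝 (ellGamma p q c)) := by
  have hfc := hf.mul_const c
  rw [one_mul] at hfc
  exact (differentiableAt_ellGamma hp hq hc h).continuousAt.tendsto.comp hfc

theorem kernel_inv_mul_mul_pow (hq0 : q ≠ 0) {ra rk ε : ℂ} (hra : ra ≠ 0) (hrk : rk ≠ 0)
    (hε : ε ≠ 0) (m n : ℕ) :
    kernel p q (rk / ra) (ε⁻¹ * (rk * q ^ (m + n))) (ra * q ^ m) =
      ellGamma p q (ε⁻¹ * (rk ^ 2 * q ^ (2 * m + n))) *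
          ellGamma p q (ε⁻¹ * (rk ^ 2 / ra ^ 2 * q ^ n)) *
          ellGamma p q (ε * (q ^ n)⁻¹) * ellGamma p q (ε * (ra ^ 2 * q ^ (2 * m + n))⁻¹) /
        (ellGamma p q (rk ^ 2 / ra ^ 2) *
          (ellGamma p q (ra ^ 2 * q ^ (2 * m)) * ellGamma p q (ra ^ 2 * q ^ (2 * m))⁻¹)) := by
  have hxz : rk / ra * (ε⁻¹ * (rk * q ^ (m + n))) * (ra * q ^ m) =
      ε⁻¹ * (rk ^ 2 * q ^ (2 * m + n)) := by
    field_simp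
    ring
  have hxz' : rk / ra * (ε⁻¹ * (rk * q ^ (m + n))) * (ra * q ^ m)⁻¹ =
      ε⁻¹ * (rk ^ 2 / ra ^ 2 * q ^ n) := by
    field_simp
    ring
  have hx'z : rk / ra * (ε⁻¹ * (rk * q ^ (m + n)))⁻¹ * (ra * q ^ m) = ε * (q ^ n)⁻¹ := by
    field_simp
    ring
  have hx'z' : rk / ra * (ε⁻¹ * (rk * q ^ (m + n)))⁻¹ * (ra * q ^ m)⁻¹ =
      ε * (ra ^ 2 * q ^ (2 * m + n))⁻¹ := by
    field_simp
    ring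
  rw [kernel, hxz, hxz', hx'z, hx'z', inv_pow, mul_pow, ← pow_mul, mul_comm m, div_pow]

theorem mul_pow_mul_pow_mul_pow_ne_one {c : ℂ} (hc : ∀ i j : ℕ, c * q ^ i * p ^ j ≠ 1)
    (l i j : ℕ) : c * q ^ l * q ^ i * p ^ j ≠ 1 := by
  rw [mul_assoc c, ← pow_add]
  exact hc _ _

/-- Of the four gamma factors in the numerator of the kernel only `Γ(t x⁻¹ z)` becomes singular
at the pinching point. -/
theorem tendsto_one_sub_mul_kernel_gamma (hp : ‖p‖ < 1) (hq : ‖q‖ < 1) (hq0 : q ≠ 0)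
    {ra rk : ℂ} (hra : ra ≠ 0) (hrk : rk ≠ 0) {m n : ℕ} (hn : ellPoch p q (q ^ n)⁻¹ n ≠ 0)
    (hka : ∀ i j : ℕ, rk ^ 2 / ra ^ 2 * q ^ i * p ^ j ≠ 1)
    (hk : ∀ i j : ℕ, rk ^ 2 * q ^ i * p ^ j ≠ 1)
    (ha : ∀ i j : ℕ, (ra ^ 2 * q ^ (2 * m + n))⁻¹ * q ^ i * p ^ j ≠ 1) :
    Tendsto (fun ε => (1 - ε) *
        kernel p q (rk / ra) (ε⁻¹ * (rk * q ^ (m + n))) (ra * q ^ m)) (𝓝[≠] 1)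
      (𝓝 (ellGamma p q (rk ^ 2 * q ^ (2 * m + n)) * ellGamma p q (rk ^ 2 / ra ^ 2 * q ^ n) *
          ((qPochInf p p * qPochInf q q)⁻¹ / ellPoch p q (q ^ n)⁻¹ n) *
          ellGamma p q (ra ^ 2 * q ^ (2 * m + n))⁻¹ /
        (ellGamma p q (rk ^ 2 / ra ^ 2) *
          (ellGamma p q (ra ^ 2 * q ^ (2 * m)) * ellGamma p q (ra ^ 2 * q ^ (2 * m))⁻¹)))) := by
  have ha0 : ra ^ 2 ≠ 0 := pow_ne_zero 2 hra
  have hk0 : rk ^ 2 ≠ 0 := pow_ne_zero 2 hrk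
  have hid : Tendsto (fun ε : ℂ => ε) (𝓝[≠] 1) (𝓝 1) := nhdsWithin_le_nhds
  have hinv : Tendsto (fun ε : ℂ => ε⁻¹) (𝓝[≠] 1) (𝓝 1) := by
    simpa only [inv_one] using hid.inv₀ one_ne_zero
  have hlim := (((tendsto_ellGamma_mul hp hq (mul_ne_zero hk0 (pow_ne_zero (2 * m + n) hq0))
        (mul_pow_mul_pow_mul_pow_ne_one hk _) hinv).mul
      (tendsto_ellGamma_mul hp hq (mul_ne_zero (div_ne_zero hk0 ha0) (pow_ne_zero n hq0))
        (mul_pow_mul_pow_mul_pow_ne_one hka _) hinv)).mul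
      (tendsto_one_sub_mul_ellGamma_mul_inv_pow hp hq hq0 hn)).mul
    (tendsto_ellGamma_mul hp hq
      (inv_ne_zero (mul_ne_zero ha0 (pow_ne_zero (2 * m + n) hq0))) ha hid)
  refine (hlim.div_const _).congr' ?_
  filter_upwards [nhdsWithin_le_nhds (isOpen_ne.mem_nhds (one_ne_zero : (1 : ℂ) ≠ 0))] with ε hε
  rw [kernel_inv_mul_mul_pow hq0 hra hrk hε]
  ring

theorem ellGamma_quotient_eq (hp : ‖p‖ < 1) (hq : ‖q‖ < 1) (hq0 : q ≠ 0) {a k : ℂ} (ha0 : a ≠ 0)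
    (hk0 : k ≠ 0) (ha1 : ‖a‖ < 1) {m n : ℕ}
    (hka : ∀ i j : ℕ, k / a * q ^ i * p ^ j ≠ 1)
    (hka' : ∀ i j : ℕ, k / a ≠ q ^ (i + 1) * p ^ (j + 1))
    (hk : ∀ i j : ℕ, k * q ^ i * p ^ j ≠ 1)
    (ha : ∀ i j : ℕ, (a * q ^ (2 * m + n))⁻¹ * q ^ i * p ^ j ≠ 1) :
    ellGamma p q (k * q ^ (2 * m + n)) * ellGamma p q (k / a * q ^ n) *
        ellGamma p q (a * q ^ (2 * m + n))⁻¹ / (ellGamma p q (k / a) *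
          (ellGamma p q (a * q ^ (2 * m)) * ellGamma p q (a * q ^ (2 * m))⁻¹)) =
      ellPoch p q k ((2 * m + n : ℕ) : ℤ) * ellPoch p q (k / a) n /
          (ellPoch p q a ((2 * m : ℕ) : ℤ) * ellPoch p q (a * q ^ (2 * m + n))⁻¹ n) *
        (ellGamma p q k / ellGamma p q a) := by
  have haq0 : a * q ^ (2 * m + n) ≠ 0 := mul_ne_zero ha0 (pow_ne_zero _ hq0)
  have hΓka : ellGamma p q (k / a) ≠ 0 := ellGamma_ne_zero hp hq (div_ne_zero hk0 ha0) hka hka'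
  have hΓinv : ellGamma p q (a * q ^ (2 * m + n))⁻¹ ≠ 0 := by
    refine ellGamma_ne_zero hp hq (inv_ne_zero haq0) ha fun i j h => ?_
    refine mul_pow_mul_pow_mul_pow_ne_one (mul_pow_mul_pow_ne_one_of_norm_lt_one hp hq ha1)
      (2 * m + n) (i + 1) (j + 1) ?_
    rw [mul_assoc _ (q ^ (i + 1)), ← h, mul_inv_cancel₀ haq0]
  have harg : (a * q ^ (2 * m))⁻¹ = (a * q ^ (2 * m + n))⁻¹ * q ^ n := by
    rw [pow_add]
    field_simp
  rw [harg, ellGamma_mul_pow hp hq hq0 hk, ellGamma_mul_pow hp hq hq0 hka,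
    ellGamma_mul_pow hp hq hq0 (mul_pow_mul_pow_ne_one_of_norm_lt_one hp hq ha1),
    ellGamma_mul_pow hp hq hq0 ha]
  generalize (a * q ^ (2 * m + n))⁻¹ = w at hΓinv ⊢
  field_simp

theorem norm_mul_pow_lt_one (hq : ‖q‖ < 1) {z : ℂ} (hz : ‖z‖ < 1) (n : ℕ) : ‖z * q ^ n‖ < 1 := by
  rw [norm_mul, norm_pow]
  exact mul_lt_one_of_nonneg_of_lt_one_left (norm_nonneg _) hz
    (pow_le_one₀ (norm_nonneg _) hq.le)

theorem mul_pow_ne_pow_mul_pow_of_le {a : ℂ} {l L : ℕ} (hl : l ≤ L)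
    (ha : ∀ i j : ℕ, a * q ^ L ≠ q ^ i * p ^ j) (i j : ℕ) : a * q ^ l ≠ q ^ i * p ^ j := by
  refine fun h => ha (i + (L - l)) j ?_
  rw [pow_add, mul_right_comm, ← h, mul_assoc, ← pow_add, Nat.add_sub_cancel' hl]

theorem tendsto_one_sub_mul_kernel (hp : ‖p‖ < 1) (hq : ‖q‖ < 1) (hq0 : q ≠ 0)
    {ra rk : ℂ} (hra0 : ra ≠ 0) (hrk0 : rk ≠ 0) (hra1 : ‖ra‖ < 1) {m N : ℕ} (hm : m ≤ N)
    (hpq : ∀ i j : ℕ, 1 ≤ i → i ≤ N → q ^ i ≠ p ^ j)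
    (hka : ∀ i j : ℕ, rk ^ 2 / ra ^ 2 * q ^ i * p ^ j ≠ 1)
    (hka' : ∀ i j : ℕ, rk ^ 2 / ra ^ 2 ≠ q ^ (i + 1) * p ^ (j + 1))
    (hk : ∀ i j : ℕ, rk ^ 2 * q ^ i * p ^ j ≠ 1)
    (ha : ∀ i j : ℕ, ra ^ 2 * q ^ (2 * N) ≠ q ^ i * p ^ j) :
    Tendsto (fun ε => (1 - ε) * kernel p q (rk / ra) (ε⁻¹ * (rk * q ^ N)) (ra * q ^ m)) (𝓝[≠] 1)
      (𝓝 ((qPochInf p p * qPochInf q q)⁻¹ * (q ^ (N * (N + 1)) *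
        (baileyMatrix p q (ra ^ 2) (rk ^ 2) N m * ((q ^ (m * (m + 1)))⁻¹ *
          (ellGamma p q (rk ^ 2) / ellGamma p q (ra ^ 2))))))) := by
  obtain ⟨n, rfl⟩ := Nat.exists_eq_add_of_le hm
  have ha0 : ra ^ 2 ≠ 0 := pow_ne_zero 2 hra0
  have ha1 : ‖ra ^ 2‖ < 1 := by
    rw [norm_pow]
    exact pow_lt_one₀ (norm_nonneg _) hra1 two_ne_zero
  have hle : ∀ l ≤ 2 * m + n, ∀ i j : ℕ, ra ^ 2 * q ^ l ≠ q ^ i * p ^ j :=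
    fun l hl => mul_pow_ne_pow_mul_pow_of_le (by omega) ha
  have hθ : ∀ l ≤ 2 * m + n, theta (ra ^ 2 * q ^ l) p ≠ 0 := fun l hl =>
    theta_ne_zero_of_norm_lt_one hp (mul_ne_zero ha0 (pow_ne_zero l hq0))
      (norm_mul_pow_lt_one hq ha1 l) fun j => by simpa using hle l hl 0 j
  have hinv : ∀ i j : ℕ, (ra ^ 2 * q ^ (2 * m + n))⁻¹ * q ^ i * p ^ j ≠ 1 := fun i j h =>
    hle _ le_rfl i j ((inv_mul_eq_one₀ (mul_ne_zero ha0 (pow_ne_zero _ hq0))).1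
      (by rwa [mul_assoc] at h))
  have hqn : ellPoch p q q n ≠ 0 := ellPoch_natCast_ne_zero fun j hj =>
    theta_ne_zero_of_norm_lt_one hp (mul_ne_zero hq0 (pow_ne_zero j hq0))
      (norm_mul_pow_lt_one hq hq j) fun l => by
        simpa only [pow_succ'] using hpq (j + 1) l (by omega) (by omega)
  have hlim := tendsto_one_sub_mul_kernel_gamma (m := m) hp hq hq0 hra0 hrk0
    (ellPoch_inv_pow_ne_zero hp hq0 hqn) hka hk hinv
  have hΓ := ellGamma_quotient_eq hp hq hq0 ha0 (pow_ne_zero 2 hrk0) ha1 hka hka' hk hinv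
  have hE := inv_ellPoch_mul_eq hp hq0 ha0 hθ hqn
  convert hlim using 2
  rw [baileyMatrix_add]
  linear_combination
    -((qPochInf p p * qPochInf q q)⁻¹ / ellPoch p q (q ^ n)⁻¹ n) * hΓ -
      (qPochInf p p * qPochInf q q)⁻¹ * ellPoch p q (rk ^ 2) ((2 * m + n : ℕ) : ℤ) *
        ellPoch p q (rk ^ 2 / ra ^ 2) n * (ellGamma p q (rk ^ 2) / ellGamma p q (ra ^ 2)) * hE

end KernelLimit

section SequencePoles

variable {p q z₀ : ℂ} {N : ℕ}

theorem seqPoles_eq_coe_image (q z₀ : ℂ) (N : ℕ) :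
    seqPoles q z₀ N = ((Finset.range (N + 1)).image fun m => z₀ * q ^ m : Finset ℂ) := by
  ext w
  simp [seqPoles, eq_comm]

theorem finite_seqPoles (q z₀ : ℂ) (N : ℕ) : (seqPoles q z₀ N).Finite := by
  rw [seqPoles_eq_coe_image]
  exact Finset.finite_toSet _

theorem injective_mul_pow (hq0 : q ≠ 0) (hq : ‖q‖ < 1) (hz₀ : z₀ ≠ 0) :
    Injective fun m : ℕ => z₀ * q ^ m := by
  intro m n h
  have hnorm : ‖q‖ ^ m = ‖q‖ ^ n := by
    rw [← norm_pow, ← norm_pow, mul_left_cancel₀ hz₀ h]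
  exact (pow_right_strictAnti₀ (norm_pos_iff.2 hq0) hq).injective hnorm

theorem norm_lt_one_of_mem_seqPoles (hq : ‖q‖ < 1) (hz₁ : ‖z₀‖ < 1) {w : ℂ}
    (hw : w ∈ seqPoles q z₀ N) : ‖w‖ < 1 := by
  obtain ⟨m, _, rfl⟩ := hw
  exact norm_mul_pow_lt_one hq hz₁ m

theorem zero_notMem_seqPoles (hq0 : q ≠ 0) (hz₀ : z₀ ≠ 0) (N : ℕ) : 0 ∉ seqPoles q z₀ N := by
  rintro ⟨m, _, h⟩
  exact mul_ne_zero hz₀ (pow_ne_zero m hq0) h.symm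

theorem inv_notMem_seqPoles (hq0 : q ≠ 0) (hq : ‖q‖ < 1) (hz₀ : z₀ ≠ 0) (hz₁ : ‖z₀‖ < 1) {w : ℂ}
    (hw : w ∈ seqPoles q z₀ N) : w⁻¹ ∉ seqPoles q z₀ N := by
  intro hw'
  have hpos : 0 < ‖w‖ := norm_pos_iff.2 (ne_of_mem_of_not_mem hw (zero_notMem_seqPoles hq0 hz₀ N))
  have hinv := norm_lt_one_of_mem_seqPoles hq hz₁ hw'
  rw [norm_inv] at hinv
  exact ((one_lt_inv₀ hpos).2 (norm_lt_one_of_mem_seqPoles hq hz₁ hw)).not_gt hinv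

theorem notMem_kernelExceptional_of_mem_seqPoles (hp : ‖p‖ < 1) (hq : ‖q‖ < 1) (hq0 : q ≠ 0)
    (hz₀ : z₀ ≠ 0) (hz₁ : ‖z₀‖ < 1) (ha : ∀ i j : ℕ, z₀ ^ 2 * q ^ (2 * N) ≠ q ^ i * p ^ j) {w : ℂ}
    (hw : w ∈ seqPoles q z₀ N) : w ∉ kernelExceptional p q := by
  rintro (h | h)
  · refine doublePochInf_ne_zero_of_norm_lt_one hp hq ?_ h
    rw [norm_mul, norm_mul, norm_pow]
    exact mul_lt_one_of_nonneg_of_lt_one_right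
      (mul_le_one₀ hp.le (norm_nonneg _) hq.le) (by positivity)
      (pow_lt_one₀ (norm_nonneg _) (norm_lt_one_of_mem_seqPoles hq hz₁ hw) two_ne_zero)
  · obtain ⟨i, j, hij⟩ := (doublePochInf_eq_zero_iff hp hq _).1 h
    obtain ⟨m, hm, rfl⟩ := hw
    refine mul_pow_ne_pow_mul_pow_of_le (Nat.mul_le_mul_left 2 hm) ha (j + 1) (i + 1) ?_
    field_simp at hij
    linear_combination -hij

theorem differentiableAt_of_differentiableOn_of_finite {A : Set ℂ} (hA : A.Finite) {α : ℂ → ℂ}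
    (hα : DifferentiableOn ℂ α {z | z ≠ 0 ∧ z ∉ A ∧ z⁻¹ ∉ A}) (z : ℂ) (hz0 : z ≠ 0) (hz : z ∉ A)
    (hz' : z⁻¹ ∉ A) : DifferentiableAt ℂ α z := by
  have hclosed := (((finite_singleton (0 : ℂ)).union hA).union
    (hA.preimage (f := fun z : ℂ => z⁻¹) inv_injective.injOn)).isClosed
  refine (hα z ⟨hz0, hz, hz'⟩).differentiableAt
    (mem_of_superset (hclosed.isOpen_compl.mem_nhds (x := z) ?_) fun w hw => ?_) <;>
  simp_all [not_or, and_assoc]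

end SequencePoles

section Pinching

variable {p q t x ra rk : ℂ} {N : ℕ} {α : ℂ → ℂ}

theorem inv_mem_kernelPoles_of_mem_seqPoles (hq0 : q ≠ 0) (hrk : rk ≠ 0) {w : ℂ}
    (hw : w ∈ seqPoles q ra N) : w⁻¹ ∈ kernelPoles p q (rk / ra) (rk * q ^ N) := by
  obtain ⟨m, hm, rfl⟩ := hw
  obtain ⟨n, rfl⟩ := Nat.exists_eq_add_of_le hm
  refine ⟨n, 0, Or.inr ?_⟩
  rw [pow_zero, mul_one, pow_add]
  field_simp

theorem inv_notMem_kernelPoles_of_forall_ne (hp0 : p ≠ 0) (hq0 : q ≠ 0) (ht : t ≠ 0) (hx : x ≠ 0)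
    (htt : ∀ i j : ℕ, t ^ 2 * q ^ i * p ^ j ≠ 1)
    (htx : ∀ i j : ℕ, (t * x) ^ 2 * q ^ i * p ^ j ≠ 1)
    (htx' : ∀ i j : ℕ, (t * x⁻¹) ^ 2 * q ^ i * p ^ j ≠ 1) {w : ℂ} (hw : w ∈ kernelPoles p q t x) :
    w⁻¹ ∉ kernelPoles p q t x := by
  intro hw'
  have hmul : w * w⁻¹ = 1 :=
    mul_inv_cancel₀ (ne_of_mem_of_not_mem hw (zero_notMem_kernelPoles hp0 hq0 ht hx))
  have htx₂ : t ^ 2 = t * x * (t * x⁻¹) := by field_simp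
  obtain ⟨i, j, h⟩ := hw
  obtain ⟨i', j', h'⟩ := hw'
  rcases h with h | h <;> rcases h' with h' | h' <;> rw [h', h] at hmul
  · exact htx (i + i') (j + j') (by rw [← hmul]; ring)
  · exact htt (i + i') (j + j') (by rw [← hmul, htx₂]; ring)
  · exact htt (i + i') (j + j') (by rw [← hmul, htx₂]; ring)
  · exact htx' (i + i') (j + j') (by rw [← hmul]; ring)

theorem exists_isDeformedContour_seqPoles (hp0 : p ≠ 0) (hp : ‖p‖ < 1) (hq0 : q ≠ 0) (hq : ‖q‖ < 1)
    (hra : ra ≠ 0) (hrk : rk ≠ 0) (hka : ∀ i j : ℕ, rk ^ 2 / ra ^ 2 * q ^ i * p ^ j ≠ 1)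
    (ha : ∀ i j : ℕ, ra ^ 2 * q ^ (2 * N) ≠ q ^ i * p ^ j)
    (hkk : ∀ i j : ℕ, (rk ^ 2) ^ 2 * q ^ (2 * N) * q ^ i * p ^ j ≠ ra ^ 2) :
    ∃ C, IsDeformedContour p q (rk / ra) (rk * q ^ N) (seqPoles q ra N) C := by
  have ht : rk / ra ≠ 0 := div_ne_zero hrk hra
  have hx : rk * q ^ N ≠ 0 := mul_ne_zero hrk (pow_ne_zero N hq0)
  refine exists_isDeformedContour hp0 hp hq0 hq ht hx
    (fun w => inv_mem_kernelPoles_of_mem_seqPoles hq0 hrk)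
    fun w => inv_notMem_kernelPoles_of_forall_ne hp0 hq0 ht hx ?_ ?_ ?_
  · simpa only [div_pow] using hka
  · refine fun i j h => hkk i j ?_
    field_simp at h
    linear_combination h
  · refine fun i j h => ha i j ?_
    field_simp at h
    linear_combination -h

theorem eventually_inv_notMem_kernelPoles (hp : ‖p‖ < 1) (hq : ‖q‖ < 1) (hq0 : q ≠ 0)
    (hra : ra ≠ 0) (hrk : rk ≠ 0) (N : ℕ) :
    ∀ᶠ ε in 𝓝[≠] (1 : ℂ), ∀ w ∈ seqPoles q ra N,
      w⁻¹ ∉ kernelPoles p q (rk / ra) (ε⁻¹ * (rk * q ^ N)) := by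
  have hev : ∀ᶠ ε in 𝓝[≠] (1 : ℂ), ∀ m ∈ Finset.range (N + 1),
      (∀ i j : ℕ, ε ≠ rk ^ 2 * q ^ N * q ^ m * q ^ i * p ^ j) ∧
        ∀ i j : ℕ, ε⁻¹ ≠ q ^ m * (q ^ N)⁻¹ * q ^ i * p ^ j :=
    (eventually_all_finset _).2 fun m _ => (eventually_ne_mul_pow_mul_pow hp hq _).and
      (eventually_inv_ne_mul_pow_mul_pow hp hq _)
  filter_upwards [hev, nhdsWithin_le_nhds (isOpen_ne.mem_nhds (one_ne_zero : (1 : ℂ) ≠ 0))]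
    with ε hε (hε0 : ε ≠ 0)
  rintro _ ⟨m, hm, rfl⟩ ⟨i, j, h | h⟩
  · refine (hε m (Finset.mem_range_succ_iff.2 hm)).1 i j ?_
    field_simp at h
    linear_combination h
  · refine (hε m (Finset.mem_range_succ_iff.2 hm)).2 i j ?_
    field_simp at h ⊢
    linear_combination h

theorem eventually_existsUnique_isEFT (hp0 : p ≠ 0) (hp : ‖p‖ < 1) (hq0 : q ≠ 0) (hq : ‖q‖ < 1)
    (hra : ra ≠ 0) (hra1 : ‖ra‖ < 1) (hrk : rk ≠ 0)
    (hα : ∀ z, z ≠ 0 → z ∉ seqPoles q ra N → z⁻¹ ∉ seqPoles q ra N → DifferentiableAt ℂ α z)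
    {C : Contour} (hC : IsDeformedContour p q (rk / ra) (rk * q ^ N) (seqPoles q ra N) C) :
    ∀ᶠ ε in 𝓝[≠] (1 : ℂ),
      ∃! b, IsEFT p q (rk / ra) (ε⁻¹ * (rk * q ^ N)) (seqPoles q ra N) α b := by
  filter_upwards [nhdsWithin_le_nhds (hC.eventually hp hq),
    nhdsWithin_le_nhds (isOpen_ne.mem_nhds (one_ne_zero : (1 : ℂ) ≠ 0)),
    eventually_inv_notMem_kernelPoles hp hq hq0 hra hrk N] with ε hCε hε0 hεA
  refine existsUnique_isEFT hp0 hp hq0 hq (div_ne_zero hrk hra)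
    (mul_ne_zero (inv_ne_zero hε0) (mul_ne_zero hrk (pow_ne_zero N hq0))) (finite_seqPoles q ra N)
    (zero_notMem_seqPoles hq0 hra N) ?_ hα
  rintro w (hw | hw) (hw' | hw')
  · exact disjoint_left.1 hCε.disjoint (Or.inl (Or.inr hw)) (Or.inl hw')
  · exact hεA _ hw' (by rwa [inv_inv])
  · exact hεA _ hw hw'
  · exact inv_notMem_seqPoles hq0 hq hra hra1 hw hw'

theorem eq_eftIntegral_add_sum_of_isEFT (hp : ‖p‖ < 1) (hq0 : q ≠ 0) (hq : ‖q‖ < 1) (ht : t ≠ 0)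
    (hx : x ≠ 0) (hra : ra ≠ 0) (hra1 : ‖ra‖ < 1)
    (ha : ∀ i j : ℕ, ra ^ 2 * q ^ (2 * N) ≠ q ^ i * p ^ j)
    (hα : ∀ z, z ≠ 0 → z ∉ seqPoles q ra N → z⁻¹ ∉ seqPoles q ra N → DifferentiableAt ℂ α z)
    (hsymm : ∀ z, z ≠ 0 → z ∉ seqPoles q ra N → z⁻¹ ∉ seqPoles q ra N → α z⁻¹ = α z) {αt : ℕ → ℂ}
    (hαt : ∀ m ≤ N, Tendsto (fun z => (1 - ra * q ^ m / z) * α z) (𝓝[≠] (ra * q ^ m)) (𝓝 (αt m)))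
    {C : Contour} (hC : IsDeformedContour p q t x (seqPoles q ra N) C) {b : ℂ}
    (hb : IsEFT p q t x (seqPoles q ra N) α b) :
    b = eftIntegral p q t x α C + 4 * Real.pi * Complex.I * kappa p q *
      ∑ m ∈ Finset.range (N + 1), kernel p q t x (ra * q ^ m) * αt m := by
  obtain ⟨C', hC', rfl⟩ := hb
  have hexc := fun s hs =>
    notMem_kernelExceptional_of_mem_seqPoles (w := s) hp hq hq0 hra hra1 ha hs
  have hinj := injective_mul_pow hq0 hq hra
  have hr : ∀ s ∈ seqPoles q ra N, Tendsto (fun z => (1 - s / z) * α z) (𝓝[≠] s)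
      (𝓝 (extend (fun m : ℕ => ra * q ^ m) αt 0 s)) := by
    rintro _ ⟨m, hm, rfl⟩
    rw [hinj.extend_apply]
    exact hαt m hm
  rw [seqPoles_eq_coe_image] at *
  simp only [Finset.mem_coe] at *
  rw [eftIntegral_eq_add_residues hp hq ht hx hα hsymm hr hexc hC' hC,
    Finset.sum_image hinj.injOn]
  simp only [hinj.extend_apply]

theorem IsDeformedContour.eventually_isEFT_eq_add_sum (hp : ‖p‖ < 1) (hq0 : q ≠ 0) (hq : ‖q‖ < 1)
    (ht : t ≠ 0) (hx : x ≠ 0) (hra : ra ≠ 0) (hra1 : ‖ra‖ < 1)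
    (ha : ∀ i j : ℕ, ra ^ 2 * q ^ (2 * N) ≠ q ^ i * p ^ j)
    (hα : ∀ z, z ≠ 0 → z ∉ seqPoles q ra N → z⁻¹ ∉ seqPoles q ra N → DifferentiableAt ℂ α z)
    (hsymm : ∀ z, z ≠ 0 → z ∉ seqPoles q ra N → z⁻¹ ∉ seqPoles q ra N → α z⁻¹ = α z) {αt : ℕ → ℂ}
    (hαt : ∀ m ≤ N, Tendsto (fun z => (1 - ra * q ^ m / z) * α z) (𝓝[≠] (ra * q ^ m)) (𝓝 (αt m)))
    {C : Contour} (hC : IsDeformedContour p q t x (seqPoles q ra N) C) :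
    ∀ᶠ ε in 𝓝[≠] (1 : ℂ), IsDeformedContour p q t (ε⁻¹ * x) (seqPoles q ra N) C ∧
      ∀ b, IsEFT p q t (ε⁻¹ * x) (seqPoles q ra N) α b →
        b = eftIntegral p q t (ε⁻¹ * x) α C + 4 * Real.pi * Complex.I * kappa p q *
          ∑ m ∈ Finset.range (N + 1), kernel p q t (ε⁻¹ * x) (ra * q ^ m) * αt m := by
  filter_upwards [nhdsWithin_le_nhds (hC.eventually hp hq),
    nhdsWithin_le_nhds (isOpen_ne.mem_nhds (one_ne_zero : (1 : ℂ) ≠ 0))] with ε hCε hε0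
  exact ⟨hCε, fun b => eq_eftIntegral_add_sum_of_isEFT hp hq0 hq ht
    (mul_ne_zero (inv_ne_zero hε0) hx) hra hra1 ha hα hsymm hαt hCε⟩

theorem four_pi_I_mul_kappa (p q : ℂ) :
    4 * Real.pi * Complex.I * kappa p q = qPochInf p p * qPochInf q q :=
  mul_div_cancel₀ _ (by simp [Real.pi_ne_zero])

theorem tendsto_one_sub_mul_of_eventually_eq_add_sum (hp : ‖p‖ < 1) (hq0 : q ≠ 0) (hq : ‖q‖ < 1)
    (hra : ra ≠ 0) (hra1 : ‖ra‖ < 1) (hrk : rk ≠ 0)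
    (hpq : ∀ i j : ℕ, 1 ≤ i → i ≤ N → q ^ i ≠ p ^ j)
    (hka : ∀ i j : ℕ, rk ^ 2 / ra ^ 2 * q ^ i * p ^ j ≠ 1)
    (hka' : ∀ i j : ℕ, rk ^ 2 / ra ^ 2 ≠ q ^ (i + 1) * p ^ (j + 1))
    (hk : ∀ i j : ℕ, rk ^ 2 * q ^ i * p ^ j ≠ 1)
    (ha : ∀ i j : ℕ, ra ^ 2 * q ^ (2 * N) ≠ q ^ i * p ^ j)
    {E β : ℂ → ℂ} {αt : ℕ → ℂ} (hE : Tendsto (fun ε => (1 - ε) * E ε) (𝓝[≠] (1 : ℂ)) (𝓝 0))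
    (hβ : ∀ᶠ ε in 𝓝[≠] (1 : ℂ), β ε = E ε + 4 * Real.pi * Complex.I * kappa p q *
      ∑ m ∈ Finset.range (N + 1),
        kernel p q (rk / ra) (ε⁻¹ * (rk * q ^ N)) (ra * q ^ m) * αt m) :
    Tendsto (fun ε => (1 - ε) * β ε) (𝓝[≠] (1 : ℂ))
      (𝓝 (q ^ (N * (N + 1)) * ∑ m ∈ Finset.range (N + 1),
        baileyMatrix p q (ra ^ 2) (rk ^ 2) N m * (αt m * (q ^ (m * (m + 1)))⁻¹ *
          (ellGamma p q (rk ^ 2) / ellGamma p q (ra ^ 2))))) := by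
  have hpp := qPochInf_self_ne_zero hp
  have hqq := qPochInf_self_ne_zero hq
  have hsum := tendsto_finsetSum (Finset.range (N + 1)) fun m hm =>
    (tendsto_one_sub_mul_kernel hp hq hq0 hra hrk hra1 (Finset.mem_range_succ_iff.1 hm)
      hpq hka hka' hk ha).mul_const (αt m)
  have hlim := hE.add (hsum.const_mul (qPochInf p p * qPochInf q q))
  rw [zero_add, Finset.mul_sum] at hlim
  rw [Finset.mul_sum]
  convert hlim.congr' ?_ using 3
  · field_simp
  · filter_upwards [hβ] with ε hε
    rw [hε, four_pi_I_mul_kappa, mul_add, mul_left_comm (1 - ε), Finset.mul_sum (a := 1 - ε)]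
    simp only [mul_assoc]

end Pinching

end EllipticBailey

theorem mainTheorem1 (p q : ℂ) (hp0 : p ≠ 0) (hp1 : ‖p‖ < 1) (hq0 : q ≠ 0) (hq1 : ‖q‖ < 1)
    (N : ℕ) (hpq : ∀ i j : ℕ, 1 ≤ i → i ≤ N → q ^ i ≠ p ^ j)
    (a k ra rk z₀ t : ℂ) (x : ℂ → ℂ)
    (hra : ra ^ 2 = a) (hrk : rk ^ 2 = k) (ha0 : a ≠ 0) (hk0 : k ≠ 0)
    (hz₀ : z₀ = ra) (ht : t = rk / ra) (hx : ∀ ε, x ε = ε⁻¹ * rk * q ^ N)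
    (hz₀1 : ‖z₀‖ < 1)
    (hka : ∀ i j : ℕ, k / a * q ^ i * p ^ j ≠ 1)
    (hka' : ∀ i j : ℕ, k / a ≠ q ^ (i + 1) * p ^ (j + 1))
    (hk : ∀ i j : ℕ, k * q ^ i * p ^ j ≠ 1)
    (ha : ∀ i j : ℕ, a * q ^ (2 * N) ≠ q ^ i * p ^ j)
    (hkk : ∀ i j : ℕ, k ^ 2 * q ^ (2 * N) * q ^ i * p ^ j ≠ a)
    (α : ℂ → ℂ) (αt : ℕ → ℂ) (A : Set ℂ) (hA : A = EllipticBailey.seqPoles q z₀ N)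
    (hαsymm : ∀ z : ℂ, z ≠ 0 → z ∉ A → z⁻¹ ∉ A → α z⁻¹ = α z)
    (hαdiff : DifferentiableOn ℂ α {z | z ≠ 0 ∧ z ∉ A ∧ z⁻¹ ∉ A})
    (hαt : ∀ m ≤ N, Tendsto (fun z => (1 - z₀ * q ^ m / z) * α z)
      (𝓝[≠] (z₀ * q ^ m)) (𝓝 (αt m))) :
    -- near the pinching point the transform of `α` is defined, independently of the contour
    (∀ᶠ ε in 𝓝[≠] (1 : ℂ), ∃! b, EllipticBailey.IsEFT p q t (x ε) A α b) ∧
    -- the contour can be deformed across the poles of `α` uniformly near `ε = 1`; the deformation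
    -- produces the residue sum, and the integral part is killed by the factor `1 - ε`
    (∃ C, EllipticBailey.IsDeformedContour p q t (x 1) A C) ∧
    (∀ C, EllipticBailey.IsDeformedContour p q t (x 1) A C →
      (∀ᶠ ε in 𝓝[≠] (1 : ℂ), EllipticBailey.IsDeformedContour p q t (x ε) A C ∧
        ∀ b, EllipticBailey.IsEFT p q t (x ε) A α b →
          b = EllipticBailey.eftIntegral p q t (x ε) α C +
            4 * Real.pi * Complex.I * EllipticBailey.kappa p q *
              ∑ m ∈ Finset.range (N + 1),
                EllipticBailey.kernel p q t (x ε) (z₀ * q ^ m) * αt m) ∧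
      Tendsto (fun ε => (1 - ε) * EllipticBailey.eftIntegral p q t (x ε) α C)
        (𝓝[≠] (1 : ℂ)) (𝓝 0)) ∧
    -- the limit exists and the renormalized sequences satisfy the matrix relation
    (∀ β : ℂ → ℂ, (∀ᶠ ε in 𝓝[≠] (1 : ℂ), EllipticBailey.IsEFT p q t (x ε) A α (β ε)) →
      ∃ βt : ℂ, Tendsto (fun ε => (1 - ε) * β ε) (𝓝[≠] (1 : ℂ)) (𝓝 βt) ∧
        βt * (q ^ (N * (N + 1)))⁻¹ =
          ∑ m ∈ Finset.range (N + 1), EllipticBailey.baileyMatrix p q a k N m *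
            (αt m * (q ^ (m * (m + 1)))⁻¹ *
              (EllipticBailey.ellGamma p q k / EllipticBailey.ellGamma p q a))) ∧
    -- the matrix is triangular
    (∀ n m : ℕ, n < m → EllipticBailey.baileyMatrix p q a k n m = 0) := by
  subst hra hrk hA hz₀ ht
  have hra0 : z₀ ≠ 0 := ne_zero_pow two_ne_zero ha0
  have hrk0 : rk ≠ 0 := ne_zero_pow two_ne_zero hk0
  have ht0 : rk / z₀ ≠ 0 := div_ne_zero hrk0 hra0
  have hx0 : rk * q ^ N ≠ 0 := mul_ne_zero hrk0 (pow_ne_zero N hq0)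
  obtain rfl : x = fun ε => ε⁻¹ * (rk * q ^ N) := funext fun ε => by rw [hx, mul_assoc]
  simp only [inv_one, one_mul]
  have hα := EllipticBailey.differentiableAt_of_differentiableOn_of_finite
    (EllipticBailey.finite_seqPoles q z₀ N) hαdiff
  have hresidue := fun C => EllipticBailey.IsDeformedContour.eventually_isEFT_eq_add_sum (C := C)
    hp1 hq0 hq1 ht0 hx0 hra0 hz₀1 ha hα hαsymm hαt
  have hnegligible := fun C =>
    EllipticBailey.tendsto_one_sub_mul_eftIntegral (C := C) hp1 hq1 ht0 hx0 hα
  obtain ⟨C₀, hC₀⟩ :=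
    EllipticBailey.exists_isDeformedContour_seqPoles hp0 hp1 hq0 hq1 hra0 hrk0 hka ha hkk
  refine ⟨EllipticBailey.eventually_existsUnique_isEFT hp0 hp1 hq0 hq1 hra0 hz₀1 hrk0 hα hC₀,
    ⟨C₀, hC₀⟩, fun C hC => ⟨hresidue C hC, hnegligible C hC⟩, fun β hβ => ⟨_,
      EllipticBailey.tendsto_one_sub_mul_of_eventually_eq_add_sum hp1 hq0 hq1 hra0 hz₀1 hrk0
        hpq hka hka' hk ha (hnegligible C₀ hC₀)
        ((hβ.and (hresidue C₀ hC₀)).mono fun ε h => h.2.2 _ h.1), ?_⟩,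
    fun n m => EllipticBailey.baileyMatrix_eq_zero hp1 hq0 _ _⟩
  rw [mul_comm, inv_mul_cancel_left₀ (pow_ne_zero _ hq0)]
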